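/- Let $X$ be a Riemannian manifold (possibly with boundary or corners) of dimension $D\ge 1$, with Riemannian distance $d$ and Riemannian volume $m$, let $\mu$ be a Borel probability measure on $X$, let $T:X\to X$ be measure preserving and ergodic for $\mu$, and let $p\in X$. Write $B(p,r)=\{x: d(x,p)<r\}$. For a sequence $(B_j)$ of sets put $E_n=\sum_{j=1}^n\mu(B_j)$. The sequence has the SBC (strong Borel–Cantelli) property if, for $\mu$-a.e. $x$, $\sum_{j=1}^n 1_{B_j}(T^jx)=E_n+o(E_n)$; it has the QSBC (quantitative SBC) property if, for every $\delta>0$ and $\mu$-a.e. $x$, $\sum_{j=1}^n 1_{B_j}(T^jx)=E_n+O(E_n^{1/2+\delta})$. We say that SBC (resp. QSBC) holds for nested balls about $p$ if every sequence $B_j=B(p,r_j)$ with $r_j>0$ non-increasing, $r_j\to0$ and $E_n\to\infty$ has the SBC (resp. QSBC) property. Assume that the density of $\mu$ at $p$ is bounded away from $0$ and $\infty$: there are constants $0<C_1<C_2<\infty$ such that $$C_1<\liminf_{r\to0^+}\frac{\mu(B(p,r))}{m(B(p,r))},\qquad \limsup_{r\to0^+}\frac{\mu(B(p,r))}{m(B(p,r))}<C_2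 ,$$ and that SBC holds for nested balls about $p$. Let $k$ be real, $\varphi(x)=d(x,p)^{-k}$ (with $\varphi(p)=\infty$) and $S_n=\sum_{j=0}^{n-1}\varphi\circ T^j$. If $k>D$, then (a) for every $\varepsilon>0$, $\displaystyle\limsup_{n\to\infty}\frac{S_n}{n^{k/D}(\log n)^{k/D+\varepsilon}}=0$ $\mu$-a.e.; (b) for every $\varepsilon>0$, $\displaystyle\liminf_{n\to\infty}\frac{S_n}{n^{k/D-\varepsilon}}\ge1$ $\mu$-a.e.; (c) for $\mu$-a.e. $x$, $S_n(x)\ge n^{k/D}(\log n)^{k/D}$ for infinitely many $n$; (d) if moreover QSBC holds for nested balls about $p$, then for every $\varepsilon>0$, $\displaystyle\liminf_{n\to\infty}\frac{S_n}{\bigl(n\,e^{-(\log n)^{1/2+\varepsilon}}\bigr)^{k/D}}>1$ $\mu$-a.e. If $k=D$, then (a) and (c) hold, and there is a constant $\delta>0$ such that $\displaystyle\liminf_{n\to\infty}\frac{S_n}{n}>\delta$ $\mu$-a.e. -/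

import Mathlib

open MeasureTheory Filter Set Bundle
open scoped Topology ENNReal Manifold

noncomputable section

namespace BirkhoffGrowth

/-- The observable `φ(x) = d(x,p)^{-k}`, with values in `[0,∞]` (and `φ(p) = ∞` when `k > 0`). -/
def obs {X : Type*} [MetricSpace X] (p : X) (k : ℝ) (x : X) : ℝ≥0∞ :=
  edist x p ^ (-k)

/-- The Birkhoff sum `S_n = ∑_{j=0}^{n-1} φ ∘ T^j` of `φ(x) = d(x,p)^{-k}`. -/
def S {X : Type*} [MetricSpace X] (T : X → X) (p : X) (k : ℝ) (n : ℕ) (x : X) : ℝ≥0∞ :=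
  ∑ j ∈ Finset.range n, obs p k (T^[j] x)

/-- `E_n = ∑_{j=1}^n μ(B_j)`. -/
def expectedHits {X : Type*} [MeasurableSpace X] (μ : Measure X) (B : ℕ → Set X) (n : ℕ) : ℝ :=
  ∑ j ∈ Finset.Icc 1 n, μ.real (B j)

/-- `∑_{j=1}^n 1_{B_j} ∘ T^j (x)`. -/
def hits {X : Type*} (T : X → X) (B : ℕ → Set X) (n : ℕ) (x : X) : ℝ :=
  ∑ j ∈ Finset.Icc 1 n, (B j).indicator (fun _ => (1 : ℝ)) (T^[j] x)

/-- The strong Borel–Cantelli property of a sequence of sets: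
`∑_{j=1}^n 1_{B_j} ∘ T^j (x) = E_n + o(E_n)` for almost every `x`. -/
def SBC {X : Type*} [MeasurableSpace X] (T : X → X) (μ : Measure X) (B : ℕ → Set X) : Prop :=
  ∀ᵐ x ∂μ, (fun n => hits T B n x - expectedHits μ B n) =o[atTop] expectedHits μ B

/-- The quantitative strong Borel–Cantelli property of a sequence of sets: for every `δ > 0`,
`∑_{j=1}^n 1_{B_j} ∘ T^j (x) = E_n + O(E_n^{1/2+δ})` for almost every `x`. -/
def QSBC {X : Type*} [MeasurableSpace X] (T : X → X) (μ : Measure X) (B : ℕ → Set X) : Prop :=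
  ∀ δ : ℝ, 0 < δ → ∀ᵐ x ∂μ,
    (fun n => hits T B n x - expectedHits μ B n) =O[atTop]
      fun n => expectedHits μ B n ^ (1 / 2 + δ)

/-- `(B_j)` is a sequence of nested open balls centred at `p`, with radii decreasing to `0`. -/
def NestedBalls {X : Type*} [MetricSpace X] (p : X) (B : ℕ → Set X) : Prop :=
  ∃ r : ℕ → ℝ, (∀ j, 0 < r j) ∧ Antitone r ∧ Tendsto r atTop (𝓝 0) ∧
    ∀ j, B j = Metric.ball p (r j)

/-- The SBC property for nested balls about `p`. As always in dynamical Borel–Cantelli lemmas, only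
sequences with `∑ μ(B_j) = ∞` are considered. -/
def SBCAt {X : Type*} [MetricSpace X] [MeasurableSpace X] (T : X → X) (μ : Measure X) (p : X) :
    Prop :=
  ∀ B : ℕ → Set X, NestedBalls p B → Tendsto (expectedHits μ B) atTop atTop → SBC T μ B

/-- The QSBC property for nested balls about `p` (for sequences with `∑ μ(B_j) = ∞`). -/
def QSBCAt {X : Type*} [MetricSpace X] [MeasurableSpace X] (T : X → X) (μ : Measure X) (p : X) :
    Prop :=
  ∀ B : ℕ → Set X, NestedBalls p B → Tendsto (expectedHits μ B) atTop atTop → QSBC T μ B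

/-- The lower derivative of `μ` with respect to `m` at the point `p`. When `dμ/dm` has a value at
`p` as a derivative of measures (for instance, when it has a version continuous at `p`), this is
that value. -/
def lowerDensity {X : Type*} [MetricSpace X] [MeasurableSpace X] (μ m : Measure X) (p : X) :
    ℝ≥0∞ :=
  liminf (fun r : ℝ => μ (Metric.ball p r) / m (Metric.ball p r)) (𝓝[>] 0)

/-- The upper derivative of `μ` with respect to `m` at the point `p`. -/
def upperDensity {X : Type*} [MetricSpace X] [MeasurableSpace X] (μ m : Measure X) (p : X) :
    ℝ≥0∞ :=
  limsup (fun r : ℝ => μ (Metric.ball p r) / m (Metric.ball p r)) (𝓝[>] 0)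

end BirkhoffGrowth

end

/-! Charts that are Lipschitz in both directions give `m(B(p,r)) ≍ r^D`, and the density bounds turn
this into `c r^D ≤ μ(B(p,r)) ≤ C r^D` for `r ≤ 1`. So a ball of radius `v^(1/D)` has measure of
order `v`, and a visit to it adds at least `v^(-k/D)` to the Birkhoff sum. The lower bounds come
from three choices of `v_j`. For `v_j = (j+1)^(-(1-η))`, SBC forces about `n^η` visits between times
`n/2` and `n`, each worth about `n^((1-η)k/D)` (`exists_mul_rpow_le_S`). Small `η` gives (b); for `k
= D` the total is linear in `n`. For `v_j = 1/((j+2) log(j+2))` the expected hits diverge, and a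
single visit at arbitrarily late times gives (c) (`frequently_le_S`). For `v_j = 1/(j+1)`, `E_n` is
of order `log n`. QSBC has error `(log n)^(1/2+δ)`, so a window of logarithmic length `(log
n)^(1/2+2δ)/2` must contain a visit, which gives (d) (`eventually_le_S_of_QSBC`). For the upper
bound put `g(y) = y^(D/k) / log(e+y)^q` with `q > 1`. Then `g ∘ φ` is integrable
(`integrable_weight`), so by the maximal ergodic theorem its Birkhoff sums are `O(n)` almost
everywhere. As `g` is subadditive for `k ≥ D`, `g(S_n) = O(n)`, and inverting `g` gives (a). -/

namespace BirkhoffGrowth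

/-! ### Bi-Lipschitz charts -/

section Charts

open scoped NNReal

attribute [local instance] normedAddCommGroupTangentSpaceVectorSpace
attribute [local instance] normedSpaceTangentSpaceVectorSpace

variable {E : Type*} [NormedAddCommGroup E] [NormedSpace ℝ E]
  {H : Type*} [TopologicalSpace H] (I : ModelWithCorners ℝ E H)
  {X : Type*} [MetricSpace X] [ChartedSpace H X] [IsManifold I 1 X]
  [RiemannianBundle (fun x : X => TangentSpace I x)]
  [IsContinuousRiemannianBundle E (fun x : X => TangentSpace I x)]
  [IsRiemannianManifold I X]

/-- The inverse of an extended chart of a Riemannian manifold is Lipschitz near the base point. -/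
theorem exists_lipschitzOnWith_extChartAt_symm (p : X) :
    ∃ C : ℝ≥0, ∃ r > 0, Metric.ball (extChartAt I p p) r ∩ range I ⊆ (extChartAt I p).target ∧
      LipschitzOnWith C (extChartAt I p).symm (Metric.ball (extChartAt I p p) r ∩ range I) := by
  rcases eventually_enorm_mfderivWithin_symm_extChartAt_lt I p with ⟨C, C_pos, hC⟩
  obtain ⟨r, r_pos, hr⟩ :=
    Metric.mem_nhdsWithin_iff.1 (inter_mem (extChartAt_target_mem_nhdsWithin p) hC)
  refine ⟨C, r, r_pos, fun x hx => (hr hx).1, fun x hx y hy => ?_⟩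
  -- The distance is at most the length of the image of the segment from `x` to `y`. Convexity of
  -- `range I` keeps the segment in the model domain, also at a boundary or corner.
  let η := ContinuousAffineMap.lineMap (R := ℝ) x y
  set γ := (extChartAt I p).symm ∘ η
  have hball : Icc 0 1 ⊆ ⇑η ⁻¹' (Metric.ball (extChartAt I p p) r ∩ range I) := by
    simp only [← image_subset_iff, ContinuousAffineMap.coe_lineMap_eq,
     ← segment_eq_image_lineMap, η]
    exact ((convex_ball _ _).inter I.convex_range).segment_subset hx hy
  have hη : Icc 0 1 ⊆ ⇑η ⁻¹' (extChartAt I p).target := fun t ht => (hr (hball ht)).1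
  have η_smooth : CMDiff[Icc 0 1] 1 η := by
    apply ContMDiff.contMDiffOn
    rw [contMDiff_iff_contDiff]
    exact ContinuousAffineMap.contDiff _
  rw [IsRiemannianManifold.out (I := I)]
  have : Manifold.riemannianEDist I ((extChartAt I p).symm x) ((extChartAt I p).symm y) ≤
      Manifold.pathELength I γ 0 1 := by
    apply Manifold.riemannianEDist_le_pathELength _ _ _ zero_le_one
    · exact (contMDiffOn_extChartAt_symm p).comp η_smooth hη
    · simp [γ, η, ContinuousAffineMap.coe_lineMap_eq]
    · simp [γ, η, ContinuousAffineMap.coe_lineMap_eq]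
  apply this.trans
  rw [← lintegral_fderiv_lineMap_eq_edist, Manifold.pathELength_eq_lintegral_mfderivWithin_Icc,
    ← lintegral_const_mul' _ _ ENNReal.coe_ne_top]
  apply setLIntegral_mono' measurableSet_Icc (fun t ht ↦ ?_)
  have : mfderiv[Icc 0 1] γ t =
      (mfderiv[range I] (extChartAt I p).symm (η t)) ∘L (mfderiv[Icc 0 1] η t) := by
    apply mfderivWithin_comp
    · exact mdifferentiableWithinAt_extChartAt_symm (hη ht)
    · exact η_smooth.mdifferentiableOn one_ne_zero t ht
    · exact hη.trans (preimage_mono (extChartAt_target_subset_range p))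
    · rw [uniqueMDiffWithinAt_iff_uniqueDiffWithinAt]
      exact uniqueDiffOn_Icc zero_lt_one t ht
  have : mfderiv[Icc 0 1] γ t 1 =
      (mfderiv[range I] (extChartAt I p).symm (η t)) (mfderiv[Icc 0 1] η t 1) := congr($this 1)
  rw [this]
  apply (ContinuousLinearMap.le_opENorm _ _).trans
  gcongr
  · exact (hr (hball ht)).2.le
  · simp only [mfderivWithin_eq_fderivWithin]
    exact le_of_eq rfl

/-- An extended chart of a Riemannian manifold is Lipschitz near the base point. -/
theorem exists_lipschitzOnWith_extChartAt (p : X) :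
    ∃ C : ℝ≥0, ∃ r > 0, Metric.ball p r ⊆ (extChartAt I p).source ∧
      LipschitzOnWith C (extChartAt I p) (Metric.ball p r) := by
  rcases eventually_enorm_mfderiv_extChartAt_lt I p with ⟨C, C_pos, hC⟩
  obtain ⟨R, R_pos, hR⟩ := Metric.mem_nhds_iff.1
    (Filter.inter_mem hC (extChartAt_source_mem_nhds (I := I) p))
  have hsub : ∀ r ≤ R, Metric.ball p r ⊆ Metric.ball p R := fun r hr => Metric.ball_subset_ball hr
  -- A path of length below `2R/3` starting in the ball of radius `R/3` stays in the ball of radius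
  -- `R`, where the derivative bound holds.
  refine ⟨C, R / 3, by positivity, fun x hx => (hR (hsub _ (by linarith) hx)).2,
    fun x hx y hy => ?_⟩
  have hxy : edist x y < ENNReal.ofReal (2 * R / 3) := by
    rw [edist_dist]
    apply (ENNReal.ofReal_lt_ofReal_iff (by positivity)).2
    have := dist_triangle_right x y p
    rw [Metric.mem_ball] at hx hy
    linarith
  have key : ∀ l : ℝ≥0∞, edist x y < l → l ≤ ENNReal.ofReal (2 * R / 3) →
      edist (extChartAt I p x) (extChartAt I p y) ≤ C * l := by
    intro l hl hlR
    rw [IsRiemannianManifold.out (I := I)] at hl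
    obtain ⟨γ, hγx, hγy, γ_smooth, hγ, -⟩ :=
      Manifold.exists_lt_locally_constant_of_riemannianEDist_lt hl zero_lt_one
    have hmem : ∀ t ∈ Icc (0 : ℝ) 1, γ t ∈ Metric.ball p R := by
      intro t ht
      have h1 : edist x (γ t) < ENNReal.ofReal (2 * R / 3) := by
        rw [IsRiemannianManifold.out (I := I)]
        calc Manifold.riemannianEDist I x (γ t) ≤ Manifold.pathELength I γ 0 t :=
              Manifold.riemannianEDist_le_pathELength γ_smooth.contMDiffOn hγx rfl ht.1
          _ ≤ Manifold.pathELength I γ 0 1 := Manifold.pathELength_mono le_rfl ht.2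
          _ < _ := hγ.trans_le hlR
      rw [edist_dist, ENNReal.ofReal_lt_ofReal_iff (by positivity)] at h1
      have := dist_triangle_left (γ t) p x
      rw [Metric.mem_ball] at hx ⊢
      linarith
    have hsrc : ∀ t ∈ Icc (0 : ℝ) 1, γ t ∈ (chartAt H p).source := fun t ht => by
      simpa [extChartAt_source] using (hR (hmem t ht)).2
    let γ' := extChartAt I p ∘ γ
    have hγ' : CMDiff[Icc 0 1] 1 γ' :=
      contMDiffOn_extChartAt.comp (I' := I) (t := (chartAt H p).source)
        γ_smooth.contMDiffOn hsrc
    calc edist (extChartAt I p x) (extChartAt I p y)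
      _ = ‖γ' 1 - γ' 0‖ₑ := by
        rw [edist_comm, edist_eq_enorm_sub]; simp [γ', hγx, hγy]
      _ ≤ ∫⁻ t' in Icc 0 1, ‖derivWithin γ' (Icc 0 1) t'‖ₑ := by
        apply enorm_sub_le_lintegral_derivWithin_Icc_of_contDiffOn_Icc _ zero_le_one
        rwa [← contMDiffOn_iff_contDiffOn]
      _ = ∫⁻ t' in Icc 0 1, ‖mfderiv[Icc 0 1] γ' t' 1‖ₑ := by
        simp_rw [← fderivWithin_derivWithin, mfderivWithin_eq_fderivWithin]
        rfl
      _ ≤ ∫⁻ t' in Icc 0 1, C * ‖mfderiv[Icc 0 1] γ t' 1‖ₑ := by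
        apply setLIntegral_mono' measurableSet_Icc (fun t' ht' ↦ ?_)
        have : mfderiv[Icc 0 1] γ' t' =
            (mfderiv% (extChartAt I p) (γ t')) ∘L (mfderiv[Icc 0 1] γ t') := by
          apply mfderiv_comp_mfderivWithin
          · exact mdifferentiableAt_extChartAt (hsrc t' ht')
          · exact (γ_smooth.mdifferentiable one_ne_zero).mdifferentiableOn _ ht'
          · rw [uniqueMDiffWithinAt_iff_uniqueDiffWithinAt]
            exact uniqueDiffOn_Icc zero_lt_one _ ht'
        have : mfderiv[Icc 0 1] γ' t' 1 =
            (mfderiv% (extChartAt I p) (γ t')) (mfderiv[Icc 0 1] γ t' 1) :=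
          congr($this 1)
        rw [this]
        apply (ContinuousLinearMap.le_opENorm _ _).trans
        gcongr
        exact (hR (hmem t' ht')).1.le
      _ = C * Manifold.pathELength I γ 0 1 := by
        rw [lintegral_const_mul' _ _ ENNReal.coe_ne_top,
            Manifold.pathELength_eq_lintegral_mfderivWithin_Icc]
      _ ≤ C * l := by gcongr
  -- `key` needs `l` strictly above the distance. If the bound failed, some such `l` would still
  -- violate it, also after truncation at `2R/3`.
  by_contra! hlt
  obtain ⟨l, hl1, hl2⟩ : ∃ l, edist x y < l ∧
      C * l < edist (extChartAt I p x) (extChartAt I p y) := by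
    have h0 : (C : ℝ≥0∞) ≠ 0 := mod_cast C_pos.ne'
    rw [mul_comm, ← ENNReal.lt_div_iff_mul_lt (Or.inl h0) (Or.inl (by simp))] at hlt
    obtain ⟨l, h1, h2⟩ := exists_between hlt
    refine ⟨l, h1, ?_⟩
    rwa [mul_comm, ← ENNReal.lt_div_iff_mul_lt (Or.inl h0) (Or.inl (by simp))]
  have h3 := key (min l (ENNReal.ofReal (2 * R / 3))) (lt_min hl1 hxy) (min_le_right _ _)
  have h4 : (C : ℝ≥0∞) * min l (ENNReal.ofReal (2 * R / 3)) ≤ C * l := by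
    gcongr; exact min_le_left _ _
  exact absurd (h3.trans h4) (not_le.2 hl2)

end Charts

/-! ### Volume of small balls -/

section Volume

open scoped NNReal

/-- The factor normalising `μHE[d]` depends only on `d`, so the Lipschitz estimate for Hausdorff
measure passes through unchanged. -/
theorem euclideanHausdorffMeasure_image_le {X Y : Type*} [EMetricSpace X] [MeasurableSpace X]
    [BorelSpace X] [EMetricSpace Y] [MeasurableSpace Y] [BorelSpace Y] {f : X → Y} {K : ℝ≥0}
    {s : Set X} (h : LipschitzOnWith K f s) (d : ℕ) :
    (μHE[d] : Measure Y) (f '' s) ≤ (K : ℝ≥0∞) ^ d * (μHE[d] : Measure X) s := by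
  have := h.hausdorffMeasure_image_le (d := d) (Nat.cast_nonneg d)
  rw [ENNReal.rpow_natCast] at this
  simp only [Measure.euclideanHausdorffMeasure_def, Measure.smul_apply, ENNReal.smul_def, smul_eq_mul]
  calc _ ≤ _ := mul_le_mul_right this _
    _ = _ := mul_left_comm _ _ _

/-- A convex set with nonempty interior has positive lower density at each of its points. -/
theorem exists_le_addHaar_ball_inter_convex {E : Type*} [NormedAddCommGroup E] [NormedSpace ℝ E]
    [FiniteDimensional ℝ E] [MeasurableSpace E] [BorelSpace E] (ν : Measure E)
    [ν.IsAddHaarMeasure] {K : Set E} (hK : Convex ℝ K) (hint : (interior K).Nonempty) {c : E}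
    (hc : c ∈ K) :
    ∃ a r₁ : ℝ, 0 < a ∧ 0 < r₁ ∧ ∀ r, 0 < r → r ≤ r₁ →
      ENNReal.ofReal (a * r ^ Module.finrank ℝ E) ≤ ν (Metric.ball c r ∩ K) := by
  obtain ⟨z, hz⟩ := hint
  obtain ⟨s, hs, hball⟩ := Metric.mem_nhds_iff.1 (mem_interior_iff_mem_nhds.1 hz)
  have hν : 0 < ν (Metric.ball 0 1) := Metric.measure_ball_pos _ _ one_pos
  have hν' : ν (Metric.ball 0 1) ≠ ∞ := measure_ball_lt_top.ne
  have hL : 0 < dist z c + s := by positivity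
  refine ⟨(s / (dist z c + s)) ^ Module.finrank ℝ E * (ν (Metric.ball 0 1)).toReal,
    dist z c + s, mul_pos (by positivity) (ENNReal.toReal_pos hν.ne' hν'), hL, fun r hr hrL => ?_⟩
  -- The homothety of centre `c` and ratio `t` maps the ball `B(z,s)` inside `K` into `K` by
  -- convexity, and into `B(c,r)` since `t (dist z c + s) = r`.
  set t := r / (dist z c + s) with ht
  have ht0 : 0 < t := by positivity
  have ht1 : t ≤ 1 := (div_le_one hL).2 hrL
  have hsub : Metric.ball (c + t • (z - c)) (t * s) ⊆ Metric.ball c r ∩ K := by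
    intro y hy
    have hy' : dist y (c + t • (z - c)) < t * s := hy
    constructor
    · have h1 : dist (c + t • (z - c)) c = t * dist z c := by
        rw [dist_eq_norm, add_sub_cancel_left, norm_smul, Real.norm_of_nonneg ht0.le, dist_eq_norm]
      have h2 := dist_triangle y (c + t • (z - c)) c
      have h3 : t * (dist z c + s) = r := by rw [ht]; field_simp
      rw [Metric.mem_ball]
      nlinarith
    · set w := z + t⁻¹ • (y - (c + t • (z - c))) with hw
      have hwK : w ∈ K := by
        apply hball
        rw [Metric.mem_ball, dist_eq_norm, hw, add_sub_cancel_left, norm_smul, norm_inv,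
          Real.norm_of_nonneg ht0.le, ← dist_eq_norm, inv_mul_lt_iff₀ ht0]
        exact hy'
      have : y = (1 - t) • c + t • w := by
        rw [hw, smul_add, smul_inv_smul₀ ht0.ne', smul_sub, sub_smul, one_smul]
        abel
      rw [this]
      exact hK hc hwK (by linarith) ht0.le (by ring)
  refine le_trans ?_ (measure_mono hsub)
  rw [Measure.addHaar_ball_of_pos ν (c + t • (z - c)) (r := t * s) (by positivity),
    ← ENNReal.ofReal_toReal hν', ← ENNReal.ofReal_mul (by positivity)]
  simp only [ENNReal.ofReal_toReal hν']
  apply le_of_eq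
  congr 1
  rw [ht, div_mul_eq_mul_div, mul_div_assoc, mul_pow]
  ring

/-- The volume of small balls in a Riemannian manifold with boundary and corners is comparable
to a power of the radius. -/
theorem exists_bounds_euclideanHausdorffMeasure_ball {E : Type*} [NormedAddCommGroup E]
    [NormedSpace ℝ E] [FiniteDimensional ℝ E]
    {H : Type*} [TopologicalSpace H] (I : ModelWithCorners ℝ E H)
    {X : Type*} [MetricSpace X] [ChartedSpace H X] [IsManifold I 1 X]
    [RiemannianBundle (fun x : X => TangentSpace I x)]
    [IsContinuousRiemannianBundle E (fun x : X => TangentSpace I x)]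
    [IsRiemannianManifold I X] [MeasurableSpace X] [BorelSpace X] (p : X) :
    ∃ a b r₀ : ℝ, 0 < a ∧ 0 < b ∧ 0 < r₀ ∧ ∀ r, 0 < r → r ≤ r₀ →
      ENNReal.ofReal (a * r ^ Module.finrank ℝ E) ≤
        (μHE[Module.finrank ℝ E] : Measure X) (Metric.ball p r) ∧
      (μHE[Module.finrank ℝ E] : Measure X) (Metric.ball p r) ≤
        ENNReal.ofReal (b * r ^ Module.finrank ℝ E) := by
  borelize E
  set D := Module.finrank ℝ E with hD
  obtain ⟨A, ra, hra, htgt, hA⟩ := exists_lipschitzOnWith_extChartAt_symm I p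
  obtain ⟨B, rb, hrb, hsrc, hB⟩ := exists_lipschitzOnWith_extChartAt I p
  set c := extChartAt I p p with hc
  have hcI : c ∈ range I := mem_range_self _
  obtain ⟨a, ρ, ha, hρ, hconv⟩ := exists_le_addHaar_ball_inter_convex
    (μHE[Module.finrank ℝ E] : Measure E) I.convex_range I.nonempty_interior hcI
  set ν : Measure E := μHE[Module.finrank ℝ E] with hνdef
  have hν' : ν (Metric.ball 0 1) ≠ ∞ := measure_ball_lt_top.ne
  have hν : 0 < ν (Metric.ball 0 1) := Metric.measure_ball_pos _ _ one_pos
  have hA1 : (0 : ℝ) < A + 1 := by positivity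
  have hB1 : (0 : ℝ) < B + 1 := by positivity
  -- `A + 1` and `B + 1` serve as positive Lipschitz constants. The four radius bounds keep the ball
  -- in the domain of the chart estimate, its image in the domain of the inverse estimate, the
  -- smaller ball in the range of the convexity bound, and that ball in the chart target.
  refine ⟨(a / (A + 1) ^ D) / (B + 1) ^ D,
    (A + 1) ^ D * ((B + 1) ^ D * (ν (Metric.ball 0 1)).toReal),
    min (min rb (ra / (B + 1))) (min ((A + 1) * ρ) (ra * (A + 1))), by positivity,
    mul_pos (by positivity) (mul_pos (by positivity) (ENNReal.toReal_pos hν.ne' hν')),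
    by positivity, fun r hr hr₀ => ?_⟩
  simp only [le_min_iff] at hr₀
  obtain ⟨⟨hr1, hr2⟩, hr3, hr4⟩ := hr₀
  have hBr : LipschitzOnWith (B + 1) (extChartAt I p) (Metric.ball p r) :=
    (hB.mono (Metric.ball_subset_ball hr1)).weaken (by simp)
  have hsrc' : Metric.ball p r ⊆ (extChartAt I p).source :=
    (Metric.ball_subset_ball hr1).trans hsrc
  constructor
  · have hsub : Metric.ball c (r / (A + 1)) ∩ range I ⊆ extChartAt I p '' Metric.ball p r := by
      intro y hy
      have hy' : y ∈ Metric.ball c ra ∩ range I :=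
        ⟨Metric.ball_subset_ball ((div_le_iff₀ hA1).2 hr4) hy.1, hy.2⟩
      refine ⟨(extChartAt I p).symm y, ?_, (extChartAt I p).right_inv (htgt hy')⟩
      have h1 := hA.dist_le_mul y hy' c ⟨Metric.mem_ball_self hra, hcI⟩
      rw [hc, extChartAt_to_inv] at h1
      rw [Metric.mem_ball]
      have h2 : dist y c < r / (A + 1) := hy.1
      rw [lt_div_iff₀ hA1] at h2
      have h3 : (0 : ℝ) ≤ dist y c := dist_nonneg
      nlinarith
    have h1 := (hconv (r / (A + 1)) (by positivity) (by rw [div_le_iff₀ hA1]; linarith)).trans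
      ((measure_mono hsub).trans (euclideanHausdorffMeasure_image_le hBr D))
    have h2 : ENNReal.ofReal ((B + 1) ^ D) = ((B + 1 : ℝ≥0) : ℝ≥0∞) ^ D := by
      rw [ENNReal.ofReal_pow hB1.le, ENNReal.ofReal, ← NNReal.coe_one, ← NNReal.coe_add,
        Real.toNNReal_coe]
    rw [← h2] at h1
    rw [div_mul_eq_mul_div, ENNReal.ofReal_div_of_pos (by positivity)]
    apply ENNReal.div_le_of_le_mul'
    refine le_trans (le_of_eq ?_) h1
    congr 1
    rw [div_pow]
    ring
  · have hsub : extChartAt I p '' Metric.ball p r ⊆ Metric.ball c ((B + 1) * r) := by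
      rintro _ ⟨y, hy, rfl⟩
      have h1 := hBr.dist_le_mul y hy p (Metric.mem_ball_self hr)
      push_cast at h1
      rw [Metric.mem_ball] at hy ⊢
      exact h1.trans_lt (mul_lt_mul_of_pos_left hy hB1)
    have hsub2 : extChartAt I p '' Metric.ball p r ⊆ Metric.ball c ra ∩ range I := by
      rintro y hy
      refine ⟨Metric.ball_subset_ball ?_ (hsub hy), ?_⟩
      · rw [le_div_iff₀ hB1] at hr2
        linarith
      · obtain ⟨z, -, rfl⟩ := hy
        exact mem_range_self _
    have hAr : LipschitzOnWith (A + 1) (extChartAt I p).symm (extChartAt I p '' Metric.ball p r) :=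
      (hA.mono hsub2).weaken (by simp)
    have himg : (extChartAt I p).symm '' (extChartAt I p '' Metric.ball p r) = Metric.ball p r :=
      (extChartAt I p).symm_image_image_of_subset_source hsrc'
    have h1 := euclideanHausdorffMeasure_image_le hAr D
    rw [himg] at h1
    refine h1.trans ?_
    have h2 : ENNReal.ofReal ((A + 1) ^ D) = ((A + 1 : ℝ≥0) : ℝ≥0∞) ^ D := by
      rw [ENNReal.ofReal_pow hA1.le, ENNReal.ofReal, ← NNReal.coe_one, ← NNReal.coe_add,
        Real.toNNReal_coe]
    rw [← h2, mul_assoc, ENNReal.ofReal_mul (by positivity)]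
    gcongr
    refine (measure_mono hsub).trans (le_of_eq ?_)
    change ν _ = _
    rw [Measure.addHaar_ball_of_pos _ _ (by positivity), ← ENNReal.ofReal_toReal hν',
      ← ENNReal.ofReal_mul (by positivity)]
    simp only [ENNReal.ofReal_toReal hν']
    congr 1
    rw [mul_pow]
    ring

end Volume

/-! ### Maximal ergodic theorem -/

section Maximal

/-- The running maximum of the Birkhoff sums `∑_{j<n} g ∘ T^j`, `0 ≤ n ≤ N`. -/
def birkhoffMax {X : Type*} (T : X → X) (g : X → ℝ) : ℕ → X → ℝ
  | 0, _ => 0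
  | N + 1, x => max 0 (g x + birkhoffMax T g N (T x))

variable {X : Type*} {T : X → X} {g : X → ℝ}

theorem birkhoffMax_nonneg (N : ℕ) (x : X) : 0 ≤ birkhoffMax T g N x := by
  cases N with
  | zero => exact le_rfl
  | succ N => exact le_max_left _ _

theorem birkhoffMax_le_succ (N : ℕ) (x : X) :
    birkhoffMax T g N x ≤ birkhoffMax T g (N + 1) x := by
  induction N generalizing x with
  | zero => exact birkhoffMax_nonneg 1 x
  | succ N ih =>
    exact max_le_max le_rfl (add_le_add le_rfl (ih (T x)))

theorem sum_le_birkhoffMax (N : ℕ) (x : X) :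
    ∑ j ∈ Finset.range N, g (T^[j] x) ≤ birkhoffMax T g N x := by
  induction N generalizing x with
  | zero => simp [birkhoffMax]
  | succ N ih =>
    rw [Finset.sum_range_succ', add_comm]
    exact (add_le_add le_rfl (ih (T x))).trans (le_max_right _ _)

variable [MeasurableSpace X] {μ : Measure X}

theorem integrable_birkhoffMax [IsFiniteMeasure μ] (hT : MeasurePreserving T μ μ)
    (hg : Integrable g μ) (N : ℕ) : Integrable (birkhoffMax T g N) μ := by
  induction N with
  | zero => exact integrable_zero X ℝ μ
  | succ N ih => exact (integrable_zero X ℝ μ).sup (hg.add (hT.integrable_comp_of_integrable ih))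

theorem measurable_birkhoffMax (hT : Measurable T) (hg : Measurable g) (N : ℕ) :
    Measurable (birkhoffMax T g N) := by
  induction N with
  | zero => exact measurable_const
  | succ N ih => exact measurable_const.max (hg.add (ih.comp hT))

/-- The maximal ergodic theorem. -/
theorem setIntegral_birkhoffMax_pos_nonneg [IsFiniteMeasure μ] (hT : MeasurePreserving T μ μ)
    (hgm : Measurable g) (hg : Integrable g μ) (N : ℕ) :
    0 ≤ ∫ x in {x | 0 < birkhoffMax T g N x}, g x ∂μ := by
  cases N with
  | zero => simp [birkhoffMax]
  | succ N =>
    set M := birkhoffMax T g (N + 1) with hM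
    set P := {x | 0 < M x} with hP
    have hMi : Integrable M μ := integrable_birkhoffMax hT hg _
    have hMT : Integrable (fun x => M (T x)) μ := hT.integrable_comp_of_integrable hMi
    have hPm : MeasurableSet P :=
      measurableSet_lt measurable_const (measurable_birkhoffMax hT.measurable hgm _)
    -- Garsia's argument: where `M > 0` the second alternative of the maximum is active, so `M = g +
    -- M_N ∘ T ≤ g + M ∘ T`. Integrating over `P` finishes, since `M` vanishes off `P` and `∫ M ∘ T
    -- = ∫ M`.
    have hle : ∀ x ∈ P, M x - M (T x) ≤ g x := by
      intro x hx
      have h1 : M x = max 0 (g x + birkhoffMax T g N (T x)) := rfl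
      have h2 : M x = g x + birkhoffMax T g N (T x) := by
        rcases max_choice 0 (g x + birkhoffMax T g N (T x)) with h | h
        · have hx' : 0 < M x := hx
          rw [h1, h] at hx'
          exact absurd hx' (lt_irrefl _)
        · rw [h1, h]
      have h3 := birkhoffMax_le_succ (T := T) (g := g) N (T x)
      linarith
    have h1 : ∫ x in P, M x ∂μ = ∫ x, M x ∂μ := by
      apply setIntegral_eq_integral_of_forall_compl_eq_zero
      intro x hx
      exact le_antisymm (not_lt.1 hx) (birkhoffMax_nonneg _ _)
    have h2 : ∫ x in P, M (T x) ∂μ ≤ ∫ x, M (T x) ∂μ :=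
      setIntegral_le_integral hMT (Eventually.of_forall fun x => birkhoffMax_nonneg _ _)
    have h3 : ∫ x, M (T x) ∂μ = ∫ x, M x ∂μ := by
      have := integral_map (μ := μ) hT.measurable.aemeasurable (f := M) (by
        rw [hT.map_eq]; exact hMi.aestronglyMeasurable)
      rw [hT.map_eq] at this
      exact this.symm
    calc (0 : ℝ) ≤ ∫ x in P, M x ∂μ - ∫ x in P, M (T x) ∂μ := by linarith
      _ = ∫ x in P, (M x - M (T x)) ∂μ := (integral_sub hMi.integrableOn hMT.integrableOn).symm
      _ ≤ ∫ x in P, g x ∂μ :=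
        setIntegral_mono_on (hMi.sub hMT).integrableOn hg.integrableOn hPm hle

/-- The Birkhoff sums of a nonnegative integrable function grow at most linearly. -/
theorem ae_exists_birkhoffSum_le [IsFiniteMeasure μ] (hT : MeasurePreserving T μ μ) {f : X → ℝ}
    (hfm : Measurable f) (hf : Integrable f μ) (hf0 : ∀ x, 0 ≤ f x) :
    ∀ᵐ x ∂μ, ∃ K : ℝ, 0 < K ∧ ∀ n : ℕ, ∑ j ∈ Finset.range n, f (T^[j] x) ≤ K * n := by
  -- Weak-type bound, from the maximal theorem applied to `f - L`. Letting `L` tend to infinity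
  -- makes the set of unbounded averages null.
  have key : ∀ L : ℝ, 0 < L →
      μ {x | ∃ n : ℕ, L * n < ∑ j ∈ Finset.range n, f (T^[j] x)} ≤
        ENNReal.ofReal ((∫ x, f x ∂μ) / L) := by
    intro L hL
    set g : X → ℝ := fun x => f x - L with hg
    have hgm : Measurable g := hfm.sub_const L
    have hgi : Integrable g μ := hf.sub (integrable_const L)
    have hsub : {x | ∃ n : ℕ, L * n < ∑ j ∈ Finset.range n, f (T^[j] x)} ⊆
        ⋃ N, {x | 0 < birkhoffMax T g N x} := by
      rintro x ⟨n, hn⟩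
      refine mem_iUnion.2 ⟨n, ?_⟩
      have := sum_le_birkhoffMax (T := T) (g := g) n x
      simp only [hg, Finset.sum_sub_distrib, Finset.sum_const, Finset.card_range,
        nsmul_eq_mul] at this
      have h2 : (0 : ℝ) < ∑ j ∈ Finset.range n, f (T^[j] x) - n * L := by linarith
      exact h2.trans_le this
    have hmono : Monotone fun N => {x | 0 < birkhoffMax T g N x} :=
      monotone_nat_of_le_succ fun N x hx => lt_of_lt_of_le hx (birkhoffMax_le_succ N x)
    refine (measure_mono hsub).trans ?_
    rw [hmono.measure_iUnion]
    refine iSup_le fun N => ?_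
    set P := {x | 0 < birkhoffMax T g N x} with hP
    have h1 := setIntegral_birkhoffMax_pos_nonneg hT hgm hgi N
    have h2 : ∫ x in P, g x ∂μ = ∫ x in P, f x ∂μ - μ.real P * L := by
      rw [integral_sub hf.integrableOn (integrable_const L).integrableOn, setIntegral_const,
        smul_eq_mul]
    have h3 : ∫ x in P, f x ∂μ ≤ ∫ x, f x ∂μ :=
      setIntegral_le_integral hf (Eventually.of_forall hf0)
    rw [ENNReal.le_ofReal_iff_toReal_le (measure_ne_top _ _)
      (div_nonneg (integral_nonneg hf0) hL.le), le_div_iff₀ hL]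
    change μ.real P * L ≤ _
    linarith
  have hzero : μ {x | ∀ m : ℕ, ∃ n : ℕ,
      ((m : ℝ) + 1) * n < ∑ j ∈ Finset.range n, f (T^[j] x)} = 0 := by
    apply le_antisymm _ bot_le
    have hlim : Tendsto (fun m : ℕ => ENNReal.ofReal ((∫ x, f x ∂μ) / ((m : ℝ) + 1))) atTop
        (𝓝 0) := by
      rw [← ENNReal.ofReal_zero]
      apply ENNReal.tendsto_ofReal
      exact tendsto_const_nhds.div_atTop
        (tendsto_atTop_add_const_right _ _ tendsto_natCast_atTop_atTop)
    refine ge_of_tendsto' hlim fun m => ?_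
    refine (measure_mono ?_).trans (key _ (by positivity))
    exact fun x hx => hx m
  have := measure_eq_zero_iff_ae_notMem.1 hzero
  filter_upwards [this] with x hx
  simp only [not_forall, not_exists, not_lt] at hx
  obtain ⟨m, hm⟩ := hx
  exact ⟨m + 1, by positivity, hm⟩

end Maximal

/-! ### Measure of balls about the point -/

section Density

/-- Two-sided bounds on the measure of all balls of radius at most one. -/
theorem exists_bounds_measure_ball {X : Type*} [MetricSpace X] [MeasurableSpace X]
    {μ m : Measure X} [IsProbabilityMeasure μ] {p : X} {D : ℕ} {a b r₀ C₁ C₂ : ℝ} (ha : 0 < a)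
    (hb : 0 < b) (hr₀ : 0 < r₀)
    (hm : ∀ r, 0 < r → r ≤ r₀ → ENNReal.ofReal (a * r ^ D) ≤ m (Metric.ball p r) ∧
      m (Metric.ball p r) ≤ ENNReal.ofReal (b * r ^ D))
    (hC₁ : 0 < C₁) (hlower : ENNReal.ofReal C₁ < lowerDensity μ m p)
    (hupper : upperDensity μ m p < ENNReal.ofReal C₂) :
    ∃ c C : ℝ, 0 < c ∧ 0 < C ∧ ∀ r, 0 < r → r ≤ 1 →
      c * r ^ D ≤ μ.real (Metric.ball p r) ∧ μ.real (Metric.ball p r) ≤ C * r ^ D := by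
  have hC₂ : 0 < C₂ := by
    by_contra h
    rw [ENNReal.ofReal_of_nonpos (not_lt.1 h)] at hupper
    exact not_lt_bot hupper
  have h1 := eventually_lt_of_lt_liminf hlower
  have h2 := eventually_lt_of_limsup_lt hupper
  obtain ⟨s, hs, hball⟩ := mem_nhdsGT_iff_exists_Ioc_subset.1 (h1.and h2)
  have hs : 0 < s := hs
  set ρ := min (min s r₀) 1 with hρ
  have hρ0 : 0 < ρ := by positivity
  have hsmall : ∀ r, 0 < r → r ≤ ρ →
      C₁ * a * r ^ D ≤ μ.real (Metric.ball p r) ∧ μ.real (Metric.ball p r) ≤ C₂ * b * r ^ D := by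
    intro r hr hrρ
    simp only [hρ, le_min_iff] at hrρ
    obtain ⟨hl, hu⟩ := hball ⟨hr, hrρ.1.1⟩
    obtain ⟨hml, hmu⟩ := hm r hr hrρ.1.2
    have hm0 : m (Metric.ball p r) ≠ 0 :=
      (lt_of_lt_of_le (ENNReal.ofReal_pos.2 (by positivity)) hml).ne'
    have hmt : m (Metric.ball p r) ≠ ∞ := (hmu.trans_lt ENNReal.ofReal_lt_top).ne
    constructor
    · rw [ENNReal.lt_div_iff_mul_lt (Or.inl hm0) (Or.inl hmt)] at hl
      have := (mul_le_mul_right hml _).trans hl.le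
      rw [← ENNReal.ofReal_mul hC₁.le] at this
      rw [mul_assoc]
      exact (ENNReal.ofReal_le_iff_le_toReal (measure_ne_top _ _)).1 this
    · rw [ENNReal.div_lt_iff (Or.inl hm0) (Or.inl hmt)] at hu
      have := hu.le.trans (mul_le_mul_right hmu _)
      rw [← ENNReal.ofReal_mul hC₂.le] at this
      rw [mul_assoc]
      exact ENNReal.toReal_le_of_le_ofReal (by positivity) this
  -- For `ρ ≤ r ≤ 1` the lower bound follows from `μ(B(p,ρ)) ≤ μ(B(p,r))` and `r^D ≤ 1`, the upper
  -- one from `μ ≤ 1 ≤ r^D / ρ^D`.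
  refine ⟨C₁ * a * ρ ^ D, max (C₂ * b) (1 / ρ ^ D), by positivity, by positivity,
    fun r hr hr1 => ?_⟩
  have hρ1 : ρ ^ D ≤ 1 := pow_le_one₀ hρ0.le (min_le_right _ _)
  have hrD1 : r ^ D ≤ 1 := pow_le_one₀ hr.le hr1
  have hrD : 0 < r ^ D := by positivity
  have hρD : 0 < ρ ^ D := by positivity
  have hCa : 0 < C₁ * a := by positivity
  rcases le_total r ρ with h | h
  · obtain ⟨hl, hu⟩ := hsmall r hr h
    refine ⟨le_trans ?_ hl, hu.trans ?_⟩
    · have : C₁ * a * ρ ^ D ≤ C₁ * a * 1 := by gcongr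
      nlinarith
    · gcongr
      exact le_max_left _ _
  · constructor
    · have := (hsmall ρ hρ0 le_rfl).1
      have h3 : μ.real (Metric.ball p ρ) ≤ μ.real (Metric.ball p r) :=
        measureReal_mono (Metric.ball_subset_ball h)
      have : C₁ * a * ρ ^ D * r ^ D ≤ C₁ * a * ρ ^ D * 1 := by gcongr
      linarith
    · have h3 : μ.real (Metric.ball p r) ≤ 1 := measureReal_le_one
      have h4 : (1 : ℝ) ≤ 1 / ρ ^ D * r ^ D := by
        rw [div_mul_eq_mul_div, one_mul, le_div_iff₀ hρD, one_mul]
        gcongr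
      have h5 : 1 / ρ ^ D * r ^ D ≤ max (C₂ * b) (1 / ρ ^ D) * r ^ D := by
        gcongr
        exact le_max_right _ _
      linarith

end Density

/-! ### Visits to shrinking balls -/

section Hits

variable {X : Type*} [MetricSpace X] {T : X → X} {p : X} {D : ℕ} {k : ℝ}

/-- The balls about `p` with radii `v_j ^ (1 / D)`. -/
def rootBall (p : X) (D : ℕ) (v : ℕ → ℝ) (j : ℕ) : Set X :=
  Metric.ball p (v j ^ (1 / (D : ℝ)))

theorem nestedBalls_rootBall (hD : 0 < D) {v : ℕ → ℝ} (hv : ∀ j, 0 < v j) (hanti : Antitone v)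
    (hlim : Tendsto v atTop (𝓝 0)) : NestedBalls p (rootBall p D v) := by
  have hD' : 0 < 1 / (D : ℝ) := by positivity
  refine ⟨fun j => v j ^ (1 / (D : ℝ)), fun j => Real.rpow_pos_of_pos (hv j) _,
    fun i j hij => Real.rpow_le_rpow (hv j).le (hanti hij) hD'.le, ?_, fun j => rfl⟩
  have := hlim.rpow_const (p := 1 / (D : ℝ)) (Or.inr hD'.le)
  rwa [Real.zero_rpow hD'.ne'] at this

/-- The slack `v j ≤ w` lets a single value `w` bound the contributions over a whole window of
times. -/
theorem le_obs_of_mem_rootBall (hD : 0 < D) (hk : 0 ≤ k) {v : ℕ → ℝ} {j : ℕ} {x : X} {w : ℝ}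
    (hw : 0 < w) (hvw : v j ≤ w) (hv : 0 < v j) (hx : x ∈ rootBall p D v j) :
    ENNReal.ofReal (w ^ (-(k / D))) ≤ obs p k x := by
  have hD' : 0 < 1 / (D : ℝ) := by positivity
  have hd : edist x p ≤ ENNReal.ofReal (w ^ (1 / (D : ℝ))) := by
    rw [edist_dist]
    apply ENNReal.ofReal_le_ofReal
    exact (Metric.mem_ball.1 hx).le.trans (Real.rpow_le_rpow hv.le hvw hD'.le)
  have hrw : w ^ (-(k / D)) = (w ^ (1 / (D : ℝ))) ^ (-k) := by
    rw [← Real.rpow_mul hw.le]; congr 1; ring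
  rw [hrw, ← ENNReal.ofReal_rpow_of_pos (Real.rpow_pos_of_pos hw _), obs, ENNReal.rpow_neg,
    ENNReal.rpow_neg]
  exact ENNReal.inv_le_inv.2 (ENNReal.rpow_le_rpow hd hk)

theorem hits_sub_hits {X : Type*} {T : X → X} (B : ℕ → Set X) {m n : ℕ} (hmn : m ≤ n) (x : X) :
    hits T B n x - hits T B m x =
      ∑ j ∈ Finset.Ioc m n, (B j).indicator (fun _ => (1 : ℝ)) (T^[j] x) := by
  have hU : Finset.Icc 1 n = Finset.Icc 1 m ∪ Finset.Ioc m n := by ext; simp; omega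
  have hdisj : Disjoint (Finset.Icc 1 m) (Finset.Ioc m n) := by
    rw [Finset.disjoint_left]; intro a; simp; omega
  rw [hits, hits, hU, Finset.sum_union hdisj, add_sub_cancel_left]

/-- Each visit to the balls between the times `m` and `n` contributes to the Birkhoff sum. -/
theorem ofReal_mul_le_S (hD : 0 < D) (hk : 0 ≤ k) {v : ℕ → ℝ} (hv : ∀ j, 0 < v j)
    (hanti : Antitone v) {m n : ℕ} (hmn : m ≤ n) (x : X) :
    ENNReal.ofReal ((hits T (rootBall p D v) n x - hits T (rootBall p D v) m x) *
      v m ^ (-(k / D))) ≤ S T p k (n + 1) x := by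
  classical
  rw [hits_sub_hits _ hmn, Finset.sum_mul,
    ENNReal.ofReal_sum_of_nonneg fun j _ => mul_nonneg (indicator_nonneg (by simp) _)
      (Real.rpow_nonneg (hv m).le _)]
  refine le_trans (Finset.sum_le_sum fun j hj => ?_)
    (Finset.sum_le_sum_of_subset (f := fun j => obs p k (T^[j] x)) (s := Finset.Ioc m n) ?_)
  · by_cases hx : T^[j] x ∈ rootBall p D v j
    · rw [indicator_of_mem hx, one_mul]
      exact le_obs_of_mem_rootBall hD hk (hv m) (hanti (Finset.mem_Ioc.1 hj).1.le) (hv j) hx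
    · simp [indicator_of_notMem hx]
  · intro j hj
    simp only [Finset.mem_Ioc, Finset.mem_range] at hj ⊢
    omega

variable [MeasurableSpace X] {μ : Measure X} {c C : ℝ}

/-- The radius `v^(1/D)` is chosen so that its `D`-th power is `v`: sums of `v` then control the
expected hits. -/
theorem measure_rootBall_bounds (hD : 0 < D)
    (hbd : ∀ r, 0 < r → r ≤ 1 →
      c * r ^ D ≤ μ.real (Metric.ball p r) ∧ μ.real (Metric.ball p r) ≤ C * r ^ D)
    {v : ℕ → ℝ} {j : ℕ} (hv : 0 < v j) (hv1 : v j ≤ 1) :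
    c * v j ≤ μ.real (rootBall p D v j) ∧ μ.real (rootBall p D v j) ≤ C * v j := by
  have h := hbd (v j ^ (1 / (D : ℝ))) (Real.rpow_pos_of_pos hv _)
    (Real.rpow_le_one hv.le hv1 (by positivity))
  have hpow : (v j ^ (1 / (D : ℝ))) ^ D = v j := by
    rw [one_div, Real.rpow_inv_natCast_pow hv.le hD.ne']
  rwa [hpow] at h

theorem le_expectedHits_sub (hD : 0 < D)
    (hbd : ∀ r, 0 < r → r ≤ 1 →
      c * r ^ D ≤ μ.real (Metric.ball p r) ∧ μ.real (Metric.ball p r) ≤ C * r ^ D)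
    {v : ℕ → ℝ} (hv : ∀ j, 0 < v j) (hv1 : ∀ j, v j ≤ 1) {m n : ℕ} (hmn : m ≤ n) :
    c * ∑ j ∈ Finset.Ioc m n, v j ≤
      expectedHits μ (rootBall p D v) n - expectedHits μ (rootBall p D v) m := by
  have hU : Finset.Icc 1 n = Finset.Icc 1 m ∪ Finset.Ioc m n := by ext; simp; omega
  have hdisj : Disjoint (Finset.Icc 1 m) (Finset.Ioc m n) := by
    rw [Finset.disjoint_left]; intro a; simp; omega
  rw [expectedHits, expectedHits, hU, Finset.sum_union hdisj, add_sub_cancel_left, Finset.mul_sum]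
  exact Finset.sum_le_sum fun j _ => (measure_rootBall_bounds hD hbd (hv j) (hv1 j)).1

theorem expectedHits_le (hD : 0 < D)
    (hbd : ∀ r, 0 < r → r ≤ 1 →
      c * r ^ D ≤ μ.real (Metric.ball p r) ∧ μ.real (Metric.ball p r) ≤ C * r ^ D)
    {v : ℕ → ℝ} (hv : ∀ j, 0 < v j) (hv1 : ∀ j, v j ≤ 1) (n : ℕ) :
    expectedHits μ (rootBall p D v) n ≤ C * ∑ j ∈ Finset.Icc 1 n, v j := by
  rw [expectedHits, Finset.mul_sum]
  exact Finset.sum_le_sum fun j _ => (measure_rootBall_bounds hD hbd (hv j) (hv1 j)).2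

theorem expectedHits_nonneg {X : Type*} [MeasurableSpace X] {μ : Measure X} (B : ℕ → Set X) (n : ℕ) : 0 ≤ expectedHits μ B n :=
  Finset.sum_nonneg fun _ _ => measureReal_nonneg

theorem expectedHits_mono {X : Type*} [MeasurableSpace X] {μ : Measure X} (B : ℕ → Set X) : Monotone (expectedHits μ B) := fun _ _ h =>
  Finset.sum_le_sum_of_subset_of_nonneg (Finset.Icc_subset_Icc_right h)
    fun _ _ _ => measureReal_nonneg

end Hits

/-! ### Power lower bounds from SBC -/

section PowerGrowth

/-- Bernoulli's inequality `(1 - 1/y)^η ≤ 1 - η/y` gives `η y^(η-1) ≤ y^η - (y-1)^η`, which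
telescopes. -/
theorem sum_rpow_le {η : ℝ} (hη : 0 < η) (hη1 : η ≤ 1) (n : ℕ) :
    ∑ j ∈ Finset.Icc 1 n, ((j : ℝ) + 1) ^ (-(1 - η)) ≤ η⁻¹ * ((n : ℝ) + 1) ^ η := by
  induction n with
  | zero => simp [hη.le]
  | succ n ih =>
    rw [Finset.sum_Icc_succ_top (by omega)]
    push_cast
    set y : ℝ := (n : ℝ) + 1 + 1 with hy
    have hy0 : 0 < y := by positivity
    have h1 := rpow_one_add_le_one_add_mul_self (s := -(1 / y)) (p := η)
      (by rw [neg_le_neg_iff, div_le_one hy0]; rw [hy]; linarith [n.cast_nonneg (α := ℝ)])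
      hη.le hη1
    have h2 : (n : ℝ) + 1 = y * (1 + -(1 / y)) := by field_simp; rw [hy]; ring
    have h3 : ((n : ℝ) + 1) ^ η ≤ y ^ η - η * y ^ (-(1 - η)) := by
      have h4 : 0 ≤ 1 + -(1 / y) := by
        have : 0 ≤ y * (1 + -(1 / y)) := by rw [← h2]; positivity
        exact nonneg_of_mul_nonneg_right this hy0
      have h5 : y ^ (-(1 - η)) = y ^ η * (1 / y) := by
        rw [neg_sub, Real.rpow_sub hy0, Real.rpow_one]; ring
      rw [h2, Real.mul_rpow hy0.le h4, h5]
      have := mul_le_mul_of_nonneg_left h1 (Real.rpow_nonneg hy0.le η)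
      linarith
    have h6 := mul_le_mul_of_nonneg_left h3 (inv_nonneg.2 hη.le)
    have h7 : η⁻¹ * (y ^ η - η * y ^ (-(1 - η))) = η⁻¹ * y ^ η - y ^ (-(1 - η)) := by
      field_simp
    linarith

variable {X : Type*} [MetricSpace X] [MeasurableSpace X] {T : X → X} {μ : Measure X} {p : X}
  {D : ℕ} {k c C : ℝ}

/-- Times in the window `(n/2, n]` provide of order `n^η` visits, each worth at least a constant
times `n^((1-η)k/D)`. -/
theorem exists_mul_rpow_le_S (hD : 0 < D) (hk : 0 ≤ k) (hc : 0 < c) (hC : 0 < C)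
    (hbd : ∀ r, 0 < r → r ≤ 1 →
      c * r ^ D ≤ μ.real (Metric.ball p r) ∧ μ.real (Metric.ball p r) ≤ C * r ^ D)
    (hSBC : SBCAt T μ p) {η : ℝ} (hη : 0 < η) (hη1 : η < 1) :
    ∃ δ : ℝ, 0 < δ ∧ ∀ᵐ x ∂μ, ∀ᶠ n : ℕ in atTop,
      ENNReal.ofReal (δ * (n : ℝ) ^ (η + (1 - η) * (k / D))) ≤ S T p k n x := by
  set v : ℕ → ℝ := fun j => ((j : ℝ) + 1) ^ (-(1 - η)) with hvdef
  have hη' : 0 < 1 - η := by linarith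
  have hv : ∀ j, 0 < v j := fun j => by positivity
  have hv1 : ∀ j, v j ≤ 1 := fun j =>
    Real.rpow_le_one_of_one_le_of_nonpos (by linarith [j.cast_nonneg (α := ℝ)]) (by linarith)
  have hanti : Antitone v := fun i j hij =>
    Real.rpow_le_rpow_of_nonpos (by positivity) (by gcongr) (by linarith)
  have hlim : Tendsto v atTop (𝓝 0) := (tendsto_rpow_neg_atTop hη').comp
    (tendsto_atTop_add_const_right _ _ tendsto_natCast_atTop_atTop)
  set B := rootBall p D v
  -- The window has at least `(n+1)/4` times, and each has `v j ≥ v n`.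
  have hinc : ∀ n : ℕ, 1 ≤ n →
      c / 4 * ((n : ℝ) + 1) ^ η ≤ expectedHits μ B n - expectedHits μ B (n / 2) := by
    intro n hn
    refine le_trans ?_ (le_expectedHits_sub hD hbd hv hv1 (Nat.div_le_self n 2))
    have h1 : ((n - n / 2 : ℕ) : ℝ) * v n ≤ ∑ j ∈ Finset.Ioc (n / 2) n, v j := by
      have := Finset.card_nsmul_le_sum (Finset.Ioc (n / 2) n) v (v n)
        fun j hj => hanti (Finset.mem_Ioc.1 hj).2
      rwa [Nat.card_Ioc, nsmul_eq_mul] at this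
    have h2 : ((n : ℝ) + 1) / 4 ≤ ((n - n / 2 : ℕ) : ℝ) := by
      have : n + 1 ≤ 4 * (n - n / 2) := by omega
      have h3 : ((n + 1 : ℕ) : ℝ) ≤ ((4 * (n - n / 2) : ℕ) : ℝ) := Nat.cast_le.2 this
      push_cast at h3 ⊢
      linarith
    have h3 : ((n : ℝ) + 1) ^ η = ((n : ℝ) + 1) * v n := by
      rw [hvdef, mul_comm, ← Real.rpow_add_one (by positivity)]
      congr 1; ring
    rw [h3]
    have h4 := mul_le_mul_of_nonneg_right h2 (hv n).le
    have h5 := mul_le_mul_of_nonneg_left (h4.trans h1) hc.le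
    linarith
  have hEle : ∀ n, expectedHits μ B n ≤ C * (η⁻¹ * ((n : ℝ) + 1) ^ η) := fun n =>
    (expectedHits_le hD hbd hv hv1 n).trans
      (mul_le_mul_of_nonneg_left (sum_rpow_le hη hη1.le n) hC.le)
  have hE : Tendsto (expectedHits μ B) atTop atTop := by
    have h1 : Tendsto (fun n : ℕ => c / 4 * ((n : ℝ) + 1) ^ η) atTop atTop :=
      ((tendsto_rpow_atTop hη).comp
        (tendsto_atTop_add_const_right _ _ tendsto_natCast_atTop_atTop)).const_mul_atTop
        (by positivity)
    refine tendsto_atTop_mono' _ ?_ h1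
    filter_upwards [eventually_ge_atTop 1] with n hn
    linarith [hinc n hn, expectedHits_nonneg (μ := μ) B (n / 2)]
  have hsbc := hSBC B (nestedBalls_rootBall hD hv hanti hlim) hE
  refine ⟨c / 8 * (1 / 2) ^ ((1 - η) * (k / D)), by positivity, ?_⟩
  filter_upwards [hsbc] with x hx
  -- With this value the SBC error at each end of the window is at most `c/16 · (n+1)^η`, so `c/4 -
  -- 2 · c/16 = c/8` remains.
  set ε₀ := c * η / (16 * C) with hε₀
  have hε₀0 : 0 < ε₀ := by positivity
  have hev := hx.bound hε₀0
  have hhalf : Tendsto (fun n : ℕ => n / 2) atTop atTop := Nat.tendsto_div_const_atTop (by simp)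
  -- Shift by one: visits up to time `n` enter the Birkhoff sum of index `n + 1`.
  rw [← map_add_atTop_eq_nat 1, eventually_map]
  filter_upwards [hev, hhalf.eventually hev, eventually_ge_atTop 1] with n h1 h2 hn
  rw [Real.norm_eq_abs, Real.norm_of_nonneg (expectedHits_nonneg _ _)] at h1 h2
  have hnn : (0 : ℝ) < (n : ℝ) + 1 := by positivity
  have hmono : expectedHits μ B (n / 2) ≤ expectedHits μ B n :=
    expectedHits_mono _ (Nat.div_le_self n 2)
  have h3 : ε₀ * expectedHits μ B n ≤ c / 16 * ((n : ℝ) + 1) ^ η := by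
    calc ε₀ * expectedHits μ B n ≤ ε₀ * (C * (η⁻¹ * ((n : ℝ) + 1) ^ η)) := by
          gcongr; exact hEle n
      _ = _ := by rw [hε₀]; field_simp
  have h4 : ε₀ * expectedHits μ B (n / 2) ≤ c / 16 * ((n : ℝ) + 1) ^ η :=
    (mul_le_mul_of_nonneg_left hmono hε₀0.le).trans h3
  have h5 : c / 8 * ((n : ℝ) + 1) ^ η ≤ hits T B n x - hits T B (n / 2) x := by
    have := hinc n hn
    have h6 := (abs_le.1 h1).1
    have h7 := (abs_le.1 h2).2
    linarith
  refine le_trans (ENNReal.ofReal_le_ofReal ?_)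
    (ofReal_mul_le_S hD hk hv hanti (Nat.div_le_self n 2) x)
  have h8 : (1 / 2) ^ ((1 - η) * (k / D)) * ((n : ℝ) + 1) ^ ((1 - η) * (k / D)) ≤
      v (n / 2) ^ (-(k / D)) := by
    rw [hvdef, ← Real.rpow_mul (by positivity), ← Real.mul_rpow (by norm_num) hnn.le, neg_mul_neg]
    apply Real.rpow_le_rpow (by positivity) _ (by positivity)
    have : n + 1 ≤ 2 * (n / 2 + 1) := by omega
    have h9 : ((n + 1 : ℕ) : ℝ) ≤ ((2 * (n / 2 + 1) : ℕ) : ℝ) := Nat.cast_le.2 this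
    push_cast at h9 ⊢
    linarith
  push_cast
  calc _ = (c / 8 * ((n : ℝ) + 1) ^ η) *
        ((1 / 2) ^ ((1 - η) * (k / D)) * ((n : ℝ) + 1) ^ ((1 - η) * (k / D))) := by
        rw [Real.rpow_add hnn]; ring
    _ ≤ _ := mul_le_mul h5 h8 (by positivity) (le_trans (by positivity) h5)

end PowerGrowth

/-! ### Lower bounds for Birkhoff sums -/

section LowerBounds

/-- Telescoping, with `log x ≤ x - 1` used once for each logarithm. It makes the expected hits
diverge for the radii of `frequently_le_S`. -/
theorem log_log_le_sum (n : ℕ) :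
    Real.log (Real.log ((n : ℝ) + 3)) ≤ Real.log (Real.log 3) +
      ∑ j ∈ Finset.Ioc 0 n, (((j : ℝ) + 2) * Real.log ((j : ℝ) + 2))⁻¹ := by
  induction n with
  | zero => simp
  | succ n ih =>
    rw [Finset.sum_Ioc_succ_top (Nat.zero_le _)]
    push_cast
    have h3 : (0 : ℝ) < (n : ℝ) + 3 := by positivity
    have hl3 : 0 < Real.log ((n : ℝ) + 3) :=
      Real.log_pos (by linarith [n.cast_nonneg (α := ℝ)])
    have hl4 : 0 < Real.log ((n : ℝ) + 1 + 3) :=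
      Real.log_pos (by linarith [n.cast_nonneg (α := ℝ)])
    have h1 : Real.log ((n : ℝ) + 1 + 3) - Real.log ((n : ℝ) + 3) ≤ 1 / ((n : ℝ) + 3) := by
      rw [← Real.log_div (by positivity) h3.ne']
      refine (Real.log_le_sub_one_of_pos (by positivity)).trans (le_of_eq ?_)
      field_simp
      ring
    have h2 : Real.log (Real.log ((n : ℝ) + 1 + 3)) - Real.log (Real.log ((n : ℝ) + 3)) ≤
        (((n : ℝ) + 3) * Real.log ((n : ℝ) + 3))⁻¹ := by
      rw [← Real.log_div hl4.ne' hl3.ne']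
      refine (Real.log_le_sub_one_of_pos (by positivity)).trans ?_
      rw [div_sub_one hl3.ne', div_le_iff₀ hl3]
      refine h1.trans (le_of_eq ?_)
      field_simp
    have h4 : (n : ℝ) + 1 + 2 = n + 3 := by ring
    rw [h4]
    linarith

theorem log_sub_log_le_sum {m n : ℕ} (hmn : m ≤ n) :
    Real.log ((n : ℝ) + 2) - Real.log ((m : ℝ) + 2) ≤
      ∑ j ∈ Finset.Ioc m n, ((j : ℝ) + 1)⁻¹ := by
  induction n, hmn using Nat.le_induction with
  | base => simp
  | succ n hmn ih =>
    rw [Finset.sum_Ioc_succ_top hmn]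
    push_cast
    have h1 : Real.log ((n : ℝ) + 1 + 2) - Real.log ((n : ℝ) + 2) ≤ ((n : ℝ) + 1 + 1)⁻¹ := by
      rw [← Real.log_div (by positivity) (by positivity)]
      refine (Real.log_le_sub_one_of_pos (by positivity)).trans (le_of_eq ?_)
      field_simp
      ring
    linarith

theorem sum_inv_le_log (n : ℕ) :
    ∑ j ∈ Finset.Icc 1 n, ((j : ℝ) + 1)⁻¹ ≤ Real.log ((n : ℝ) + 1) := by
  induction n with
  | zero => simp
  | succ n ih =>
    rw [Finset.sum_Icc_succ_top (by omega)]
    push_cast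
    have h1 : Real.log ((n : ℝ) + 1) - Real.log ((n : ℝ) + 1 + 1) ≤ -((n : ℝ) + 1 + 1)⁻¹ := by
      rw [← Real.log_div (by positivity) (by positivity)]
      refine (Real.log_le_sub_one_of_pos (by positivity)).trans (le_of_eq ?_)
      field_simp
      ring
    linarith

variable {X : Type*} [MetricSpace X] [MeasurableSpace X] {T : X → X} {μ : Measure X} {p : X}
  {D : ℕ} {k c C : ℝ}

/-- Divergence of `E_n` makes the hit counts unbounded, so there are arbitrarily late visits; one
visit already gives the required size. -/
theorem frequently_le_S (hD : 0 < D) (hk : 0 ≤ k) (hc : 0 < c)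
    (hbd : ∀ r, 0 < r → r ≤ 1 →
      c * r ^ D ≤ μ.real (Metric.ball p r) ∧ μ.real (Metric.ball p r) ≤ C * r ^ D)
    (hSBC : SBCAt T μ p) :
    ∀ᵐ x ∂μ, ∃ᶠ n : ℕ in atTop,
      ENNReal.ofReal ((n : ℝ) ^ (k / D) * Real.log n ^ (k / D)) ≤ S T p k n x := by
  set v : ℕ → ℝ := fun j => (((j : ℝ) + 2) * Real.log ((j : ℝ) + 2))⁻¹ with hvdef
  have hlog : ∀ j : ℕ, 0 < Real.log ((j : ℝ) + 2) := fun j =>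
    Real.log_pos (by linarith [j.cast_nonneg (α := ℝ)])
  have hv : ∀ j, 0 < v j := fun j => by have := hlog j; positivity
  have hanti : Antitone v := by
    intro i j hij
    have := hlog i
    apply inv_anti₀ (by positivity)
    have : (i : ℝ) ≤ j := Nat.cast_le.2 hij
    gcongr
  have hv1 : ∀ j, v j ≤ 1 := by
    refine fun j => (hanti (Nat.zero_le j)).trans (inv_le_one_of_one_le₀ ?_)
    have := Real.log_two_gt_d9
    simp only [Nat.cast_zero, zero_add]
    linarith
  have hadd : Tendsto (fun j : ℕ => (j : ℝ) + 2) atTop atTop :=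
    tendsto_atTop_add_const_right _ _ tendsto_natCast_atTop_atTop
  have hlim : Tendsto v atTop (𝓝 0) :=
    tendsto_inv_atTop_zero.comp (hadd.atTop_mul_atTop₀ (Real.tendsto_log_atTop.comp hadd))
  set B := rootBall p D v
  have hE : Tendsto (expectedHits μ B) atTop atTop := by
    have h1 : Tendsto (fun n : ℕ => c * (Real.log (Real.log ((n : ℝ) + 3)) +
        -Real.log (Real.log 3))) atTop atTop := by
      apply Tendsto.const_mul_atTop hc
      apply tendsto_atTop_add_const_right
      exact Real.tendsto_log_atTop.comp (Real.tendsto_log_atTop.comp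
        (tendsto_atTop_add_const_right _ _ tendsto_natCast_atTop_atTop))
    refine tendsto_atTop_mono (fun n => ?_) h1
    have h2 := le_expectedHits_sub hD hbd hv hv1 (Nat.zero_le n)
    have h3 := expectedHits_nonneg (μ := μ) (rootBall p D v) 0
    have h4 := mul_le_mul_of_nonneg_left (log_log_le_sum n) hc.le
    have h5 : c * (Real.log (Real.log ((n : ℝ) + 3)) + -Real.log (Real.log 3)) ≤
      c * ∑ j ∈ Finset.Ioc 0 n, v j := by linarith
    linarith
  filter_upwards [hSBC B (nestedBalls_rootBall hD hv hanti hlim) hE] with x hx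
  have hhits : Tendsto (fun n => hits T B n x) atTop atTop := by
    refine tendsto_atTop_mono' _ ?_ (hE.const_mul_atTop (r := 1 / 2) (by norm_num))
    filter_upwards [hx.bound (c := 1 / 2) (by norm_num)] with n hn
    rw [Real.norm_eq_abs, Real.norm_of_nonneg (expectedHits_nonneg _ _)] at hn
    linarith [(abs_le.1 hn).1]
  rw [frequently_atTop]
  intro N
  obtain ⟨n, hn, hNn⟩ := ((hhits.eventually_gt_atTop (hits T B N x)).and
    (eventually_ge_atTop N)).exists
  have hpos : 0 < ∑ j ∈ Finset.Ioc N n, (B j).indicator (fun _ => (1 : ℝ)) (T^[j] x) := by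
    rw [← hits_sub_hits B hNn]; linarith
  obtain ⟨j, hj, hj0⟩ := Finset.exists_ne_zero_of_sum_ne_zero hpos.ne'
  have hjB : T^[j] x ∈ B j := mem_of_indicator_ne_zero hj0
  -- The visit at time `j` is the last term of the sum of index `j + 1`, and `(j+2) log(j+2)`
  -- dominates `(j+1) log(j+1)`.
  refine ⟨j + 1, by rw [Finset.mem_Ioc] at hj; omega, ?_⟩
  refine le_trans (ENNReal.ofReal_le_ofReal ?_)
    ((le_obs_of_mem_rootBall hD hk (hv j) le_rfl (hv j) hjB).trans
      (Finset.single_le_sum (f := fun j => obs p k (T^[j] x)) (fun _ _ => zero_le)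
        (Finset.self_mem_range_succ j)))
  have hl1 : 0 ≤ Real.log ((j : ℝ) + 1) := Real.log_nonneg (by linarith [j.cast_nonneg (α := ℝ)])
  have hl2 := hlog j
  push_cast
  rw [← Real.mul_rpow (by positivity) hl1, hvdef, Real.inv_rpow (by positivity),
    Real.rpow_neg (by positivity), inv_inv]
  gcongr <;> norm_num

theorem one_le_liminf_S_div (hD : 0 < D) (hkD : (D : ℝ) < k) (hc : 0 < c) (hC : 0 < C)
    (hbd : ∀ r, 0 < r → r ≤ 1 →
      c * r ^ D ≤ μ.real (Metric.ball p r) ∧ μ.real (Metric.ball p r) ≤ C * r ^ D)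
    (hSBC : SBCAt T μ p) {ε : ℝ} (hε : 0 < ε) :
    ∀ᵐ x ∂μ, 1 ≤ liminf (fun n : ℕ => S T p k n x /
      ENNReal.ofReal ((n : ℝ) ^ (k / D - ε))) atTop := by
  have hD' : (0 : ℝ) < D := Nat.cast_pos.2 hD
  have hk : 0 < k := hD'.trans hkD
  have hκ : 0 < k / D := by positivity
  -- This makes the exponent `η + (1-η)k/D` at least `k/D - ε/2`; the spare `n^(ε/2)` absorbs the
  -- constant `δ`.
  set η := min (1 / 2) (ε / (2 * (k / D))) with hη
  have hη0 : 0 < η := by positivity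
  have hη1 : η < 1 := (min_le_left _ _).trans_lt (by norm_num)
  have hηε : η * (k / D) ≤ ε / 2 := by
    calc η * (k / D) ≤ ε / (2 * (k / D)) * (k / D) := by gcongr; exact min_le_right _ _
      _ = ε / 2 := by field_simp
  obtain ⟨δ, hδ, hae⟩ := exists_mul_rpow_le_S hD hk.le hc hC hbd hSBC hη0 hη1
  filter_upwards [hae] with x hx
  refine le_liminf_of_le (by isBoundedDefault) ?_
  have hlarge : ∀ᶠ n : ℕ in atTop, δ⁻¹ ≤ (n : ℝ) ^ (ε / 2) :=
    ((tendsto_rpow_atTop (half_pos hε)).comp tendsto_natCast_atTop_atTop).eventually_ge_atTop _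
  filter_upwards [hx, hlarge, eventually_ge_atTop 1] with n h1 h2 hn
  have hn1 : (1 : ℝ) ≤ n := Nat.one_le_cast.2 hn
  have hn0 : (0 : ℝ) < n := by linarith
  rw [ENNReal.le_div_iff_mul_le (Or.inl (ENNReal.ofReal_pos.2 (by positivity)).ne')
    (Or.inl ENNReal.ofReal_ne_top), one_mul]
  refine le_trans (ENNReal.ofReal_le_ofReal ?_) h1
  calc (n : ℝ) ^ (k / D - ε) = δ * (δ⁻¹ * (n : ℝ) ^ (k / D - ε)) := by field_simp
    _ ≤ δ * ((n : ℝ) ^ (ε / 2) * (n : ℝ) ^ (k / D - ε)) := by gcongr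
    _ ≤ _ := by
      rw [← Real.rpow_add hn0]
      exact mul_le_mul_of_nonneg_left
        (Real.rpow_le_rpow_of_exponent_le hn1 (by linarith)) hδ.le

theorem exists_lt_liminf_S_div (hD : 0 < D) (hkD : k = D) (hc : 0 < c) (hC : 0 < C)
    (hbd : ∀ r, 0 < r → r ≤ 1 →
      c * r ^ D ≤ μ.real (Metric.ball p r) ∧ μ.real (Metric.ball p r) ≤ C * r ^ D)
    (hSBC : SBCAt T μ p) :
    ∃ δ : ℝ, 0 < δ ∧ ∀ᵐ x ∂μ, ENNReal.ofReal δ <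
      liminf (fun n : ℕ => S T p k n x / (n : ℝ≥0∞)) atTop := by
  have hD' : (0 : ℝ) < D := Nat.cast_pos.2 hD
  -- For `k = D` the exponent `η + (1-η)k/D` is `1` whatever `η` is, so `1/2` is arbitrary.
  obtain ⟨δ, hδ, hae⟩ := exists_mul_rpow_le_S hD (hkD ▸ hD'.le) hc hC hbd hSBC
    (η := 1 / 2) (by norm_num) (by norm_num)
  refine ⟨δ / 2, by positivity, ?_⟩
  filter_upwards [hae] with x hx
  have hlt : ENNReal.ofReal (δ / 2) < ENNReal.ofReal δ :=
    (ENNReal.ofReal_lt_ofReal_iff hδ).2 (by linarith)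
  refine hlt.trans_le (le_liminf_of_le (by isBoundedDefault) ?_)
  filter_upwards [hx, eventually_ge_atTop 1] with n h1 hn
  rw [ENNReal.le_div_iff_mul_le (Or.inl (by simp; omega)) (Or.inl (by simp))]
  refine le_trans (le_of_eq ?_) h1
  rw [hkD, div_self hD'.ne', ENNReal.ofReal_mul hδ.le]
  norm_num

/-- Under a quantitative Borel–Cantelli property there is a visit to the balls of measure
comparable to `1 / j` between the times `n e^{-L / 2}` and `n`, where
`L = (log n) ^ (1 / 2 + 2δ)`. -/
theorem eventually_le_S_of_QSBC (hD : 0 < D) (hk : 0 ≤ k) (hc : 0 < c) (hC : 0 < C)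
    (hbd : ∀ r, 0 < r → r ≤ 1 →
      c * r ^ D ≤ μ.real (Metric.ball p r) ∧ μ.real (Metric.ball p r) ≤ C * r ^ D)
    (hQ : QSBCAt T μ p) {δ : ℝ} (hδ : 0 < δ) (hδ1 : 2 * δ ≤ 1 / 2) :
    ∀ᵐ x ∂μ, ∀ᶠ n : ℕ in atTop,
      ENNReal.ofReal ((n * Real.exp (-(Real.log n ^ (1 / 2 + 2 * δ) / 2))) ^ (k / D)) ≤
        S T p k n x := by
  set v : ℕ → ℝ := fun j => ((j : ℝ) + 1)⁻¹ with hvdef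
  have hv : ∀ j, 0 < v j := fun j => by positivity
  have hv1 : ∀ j, v j ≤ 1 := fun j =>
    inv_le_one_of_one_le₀ (by linarith [j.cast_nonneg (α := ℝ)])
  have hanti : Antitone v := fun i j hij => by
    have : (i : ℝ) ≤ j := Nat.cast_le.2 hij
    exact inv_anti₀ (by positivity) (by linarith)
  have hlim : Tendsto v atTop (𝓝 0) := tendsto_inv_atTop_zero.comp
    (tendsto_atTop_add_const_right _ _ tendsto_natCast_atTop_atTop)
  set B := rootBall p D v
  have hinc : ∀ m n : ℕ, m ≤ n → c * (Real.log ((n : ℝ) + 2) - Real.log ((m : ℝ) + 2)) ≤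
      expectedHits μ B n - expectedHits μ B m := fun m n hmn =>
    (mul_le_mul_of_nonneg_left (log_sub_log_le_sum hmn) hc.le).trans
      (le_expectedHits_sub hD hbd hv hv1 hmn)
  have hEle : ∀ n : ℕ, expectedHits μ B n ≤ C * Real.log ((n : ℝ) + 1) := fun n =>
    (expectedHits_le hD hbd hv hv1 n).trans (mul_le_mul_of_nonneg_left (sum_inv_le_log n) hC.le)
  have hE : Tendsto (expectedHits μ B) atTop atTop := by
    have h1 : Tendsto (fun n : ℕ => c * (Real.log ((n : ℝ) + 2) +
        -Real.log (((0 : ℕ) : ℝ) + 2))) atTop atTop := by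
      apply Tendsto.const_mul_atTop hc
      apply tendsto_atTop_add_const_right
      exact Real.tendsto_log_atTop.comp
        (tendsto_atTop_add_const_right _ _ tendsto_natCast_atTop_atTop)
    refine tendsto_atTop_mono (fun n => ?_) h1
    have h2 := hinc 0 n (Nat.zero_le n)
    have h3 := expectedHits_nonneg (μ := μ) B 0
    rw [← sub_eq_add_neg]
    linarith
  filter_upwards [hQ B (nestedBalls_rootBall hD hv hanti hlim) hE δ hδ] with x hx
  obtain ⟨K, hK, hO⟩ := hx.exists_pos
  have hev := hO.bound
  set L : ℝ → ℝ := fun u => u ^ (1 / 2 + 2 * δ) with hL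
  set m : ℕ → ℕ := fun n => ⌊(n : ℝ) * Real.exp (-(L (Real.log n) / 2))⌋₊ with hm
  have hlogn : Tendsto (fun n : ℕ => Real.log n) atTop atTop :=
    Real.tendsto_log_atTop.comp tendsto_natCast_atTop_atTop
  -- Since the exponent in `L` is at most `1`, the window starts no earlier than about `√n`; hence
  -- its left end tends to infinity.
  have hexp : ∀ᶠ n : ℕ in atTop, Real.exp (Real.log n / 2) ≤
      (n : ℝ) * Real.exp (-(L (Real.log n) / 2)) := by
    filter_upwards [hlogn.eventually_ge_atTop 1, eventually_ge_atTop 1] with n h1 hn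
    have hn0 : (0 : ℝ) < n := by exact_mod_cast hn
    nth_rw 2 [← Real.exp_log hn0]
    rw [← Real.exp_add]
    apply Real.exp_le_exp.2
    have : L (Real.log n) ≤ Real.log n ^ (1 : ℝ) :=
      Real.rpow_le_rpow_of_exponent_le h1 (by linarith)
    rw [Real.rpow_one] at this
    linarith
  have hmain : Tendsto (fun n : ℕ => (n : ℝ) * Real.exp (-(L (Real.log n) / 2))) atTop atTop :=
    tendsto_atTop_mono' _ hexp
      (Real.tendsto_exp_atTop.comp (hlogn.atTop_div_const (by norm_num)))
  have hmlim : Tendsto m atTop atTop := tendsto_nat_floor_atTop.comp hmain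
  have hsucc : Tendsto (fun n : ℕ => n - 1) atTop atTop := tendsto_sub_atTop_nat 1
  -- With `u = log n`, the left side bounds the QSBC errors at both ends and the right side is the
  -- expected number of hits in the window. The gain is `L u = u^δ · u^(1/2+δ)`; the `log 2` pays
  -- for `m + 2 ≤ 2y`.
  have hcmp : ∀ᶠ u : ℝ in atTop, 2 * K * C ^ (1 / 2 + δ) * u ^ (1 / 2 + δ) <
      c * (L u / 2 - Real.log 2) := by
    have h1 : ∀ᶠ u : ℝ in atTop, 2 * K * C ^ (1 / 2 + δ) + c * Real.log 2 < c / 2 * u ^ δ :=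
      ((tendsto_rpow_atTop hδ).const_mul_atTop (half_pos hc)).eventually_gt_atTop _
    filter_upwards [h1, eventually_ge_atTop 1] with u h2 hu
    have hu0 : 0 < u := by linarith
    have h3 : L u = u ^ δ * u ^ (1 / 2 + δ) := by
      rw [← Real.rpow_add hu0]
      change u ^ _ = u ^ _
      congr 1
      ring
    have h4 : 1 ≤ u ^ (1 / 2 + δ) := Real.one_le_rpow hu (by positivity)
    have h5 : 0 < c * Real.log 2 := mul_pos hc (Real.log_pos (by norm_num))
    rw [h3]
    nlinarith
  filter_upwards [hsucc.eventually hev, hmlim.eventually hev, hlogn.eventually hcmp,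
    hmain.eventually_ge_atTop 2, hlogn.eventually_ge_atTop 1, eventually_ge_atTop 1]
    with n h1 h2 h3 h4 h5 hn
  obtain ⟨n, rfl⟩ : ∃ n', n = n' + 1 := ⟨n - 1, by omega⟩
  rw [Nat.add_sub_cancel] at h1
  set y : ℝ := ((n + 1 : ℕ) : ℝ) * Real.exp (-(L (Real.log (n + 1 : ℕ)) / 2)) with hy
  set u := Real.log ((n + 1 : ℕ) : ℝ) with hu
  have hLpos : 0 < L u := Real.rpow_pos_of_pos (by linarith) _
  have hn0 : (0 : ℝ) < ((n + 1 : ℕ) : ℝ) := by positivity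
  have hmy : (m (n + 1) : ℝ) ≤ y := Nat.floor_le (by positivity)
  have hmn : m (n + 1) ≤ n := by
    have : y < ((n + 1 : ℕ) : ℝ) := by
      rw [hy]
      exact mul_lt_of_lt_one_right hn0 (Real.exp_lt_one_iff.2 (by linarith))
    have : (m (n + 1) : ℝ) < ((n + 1 : ℕ) : ℝ) := by linarith
    exact Nat.lt_succ_iff.1 (Nat.cast_lt.1 this)
  have hgap : c * (L u / 2 - Real.log 2) ≤
      expectedHits μ B n - expectedHits μ B (m (n + 1)) := by
    refine le_trans (mul_le_mul_of_nonneg_left ?_ hc.le) (hinc _ _ hmn)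
    have hy0 : 0 < y := by linarith
    have h6 : Real.log ((m (n + 1) : ℝ) + 2) ≤ Real.log (2 * y) :=
      Real.log_le_log (by positivity) (by linarith)
    rw [Real.log_mul two_ne_zero hy0.ne', hy, Real.log_mul hn0.ne' (Real.exp_ne_zero _),
      Real.log_exp] at h6
    have h7 : u ≤ Real.log ((n : ℝ) + 2) :=
      Real.log_le_log hn0 (by push_cast; linarith)
    linarith
  have hpow : expectedHits μ B n ^ (1 / 2 + δ) ≤ C ^ (1 / 2 + δ) * u ^ (1 / 2 + δ) := by
    rw [← Real.mul_rpow hC.le (by linarith)]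
    refine Real.rpow_le_rpow (expectedHits_nonneg _ _) ?_ (by positivity)
    have := hEle n
    rwa [hu, Nat.cast_add, Nat.cast_one]
  have hpow' : expectedHits μ B (m (n + 1)) ^ (1 / 2 + δ) ≤ expectedHits μ B n ^ (1 / 2 + δ) :=
    Real.rpow_le_rpow (expectedHits_nonneg _ _) (expectedHits_mono _ hmn) (by positivity)
  rw [Real.norm_eq_abs, Real.norm_of_nonneg (Real.rpow_nonneg (expectedHits_nonneg _ _) _)]
    at h1 h2
  have hhits : 0 < hits T B n x - hits T B (m (n + 1)) x := by
    have h6 := (abs_le.1 h1).1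
    have h7 := (abs_le.1 h2).2
    have h8 := mul_le_mul_of_nonneg_left hpow hK.le
    have h9 := mul_le_mul_of_nonneg_left hpow' hK.le
    linarith
  rw [hits_sub_hits B hmn] at hhits
  obtain ⟨j, hj, hj0⟩ := Finset.exists_ne_zero_of_sum_ne_zero hhits.ne'
  have hjB : T^[j] x ∈ B j := mem_of_indicator_ne_zero hj0
  rw [Finset.mem_Ioc] at hj
  refine le_trans (ENNReal.ofReal_le_ofReal ?_)
    ((le_obs_of_mem_rootBall hD hk (hv (m (n + 1))) (hanti hj.1.le) (hv j) hjB).trans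
      (Finset.single_le_sum (f := fun j => obs p k (T^[j] x)) (fun _ _ => zero_le)
        (Finset.mem_range.2 (Nat.lt_succ_iff.2 hj.2))))
  -- Here `1 / v m = m + 1` exceeds `y` because `m` is the floor of `y`.
  rw [hvdef, Real.inv_rpow (by positivity), Real.rpow_neg (by positivity), inv_inv]
  exact Real.rpow_le_rpow (by positivity) (Nat.lt_floor_add_one _).le (by positivity)

theorem one_lt_liminf_S_div_of_QSBC (hD : 0 < D) (hk : 0 < k) (hc : 0 < c) (hC : 0 < C)
    (hbd : ∀ r, 0 < r → r ≤ 1 →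
      c * r ^ D ≤ μ.real (Metric.ball p r) ∧ μ.real (Metric.ball p r) ≤ C * r ^ D)
    (hQ : QSBCAt T μ p) {ε : ℝ} (hε : 0 < ε) :
    ∀ᵐ x ∂μ, 1 < liminf (fun n : ℕ => S T p k n x /
      ENNReal.ofReal ((n : ℝ) ^ (k / D) *
        Real.exp (-(Real.log n) ^ (1 / 2 + ε)) ^ (k / D))) atTop := by
  have hD' : (0 : ℝ) < D := Nat.cast_pos.2 hD
  have hκ : 0 < k / D := by positivity
  -- Then `2δ ≤ ε`. The factor `1/2` in the exponent of the previous bound leaves `exp((k/D)(log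
  -- n)^(1/2+ε)/2)`, eventually at least `2`, whence the strict inequality.
  set δ := min ε (1 / 2) / 2 with hδ
  have hδ0 : 0 < δ := by positivity
  have hδ2 : 2 * δ = min ε (1 / 2) := by rw [hδ]; ring
  filter_upwards [eventually_le_S_of_QSBC hD hk.le hc hC hbd hQ hδ0
    (hδ2.trans_le (min_le_right _ _))] with x hx
  refine lt_of_lt_of_le (by norm_num : (1 : ℝ≥0∞) < 2)
    (le_liminf_of_le (by isBoundedDefault) ?_)
  have hlogn : Tendsto (fun n : ℕ => Real.log n) atTop atTop :=
    Real.tendsto_log_atTop.comp tendsto_natCast_atTop_atTop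
  have hlarge : ∀ᶠ n : ℕ in atTop,
      2 / (k / D) * Real.log 2 ≤ Real.log n ^ (1 / 2 + ε) :=
    ((tendsto_rpow_atTop (by positivity)).comp hlogn).eventually_ge_atTop _
  filter_upwards [hx, hlarge, hlogn.eventually_ge_atTop 1, eventually_ge_atTop 1]
    with n h1 h2 h3 hn
  have hn0 : (0 : ℝ) < n := by exact_mod_cast hn
  have hpos : 0 < (n : ℝ) ^ (k / D) * Real.exp (-(Real.log n) ^ (1 / 2 + ε)) ^ (k / D) := by
    positivity
  rw [ENNReal.le_div_iff_mul_le (Or.inl (ENNReal.ofReal_pos.2 hpos).ne')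
    (Or.inl ENNReal.ofReal_ne_top)]
  refine le_trans ?_ h1
  rw [← ENNReal.ofReal_ofNat 2, ← ENNReal.ofReal_mul (by norm_num)]
  apply ENNReal.ofReal_le_ofReal
  have h4 : Real.log n ^ (1 / 2 + 2 * δ) ≤ Real.log n ^ (1 / 2 + ε) :=
    Real.rpow_le_rpow_of_exponent_le h3 (by rw [hδ2]; linarith [min_le_left ε (1 / 2)])
  rw [Real.mul_rpow hn0.le (Real.exp_pos _).le, ← Real.exp_mul, ← Real.exp_mul, mul_left_comm]
  gcongr
  nth_rw 1 [← Real.exp_log two_pos]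
  rw [← Real.exp_add]
  apply Real.exp_le_exp.2
  have h5 : Real.log 2 ≤ k / D / 2 * Real.log n ^ (1 / 2 + ε) := by
    calc Real.log 2 = k / D / 2 * (2 / (k / D) * Real.log 2) := by field_simp
      _ ≤ _ := by gcongr
  nlinarith

end LowerBounds

/-! ### Upper bound by a borderline integrable weight -/

section UpperBound

theorem one_le_log_exp_one_add {y : ℝ} (hy : 0 ≤ y) : 1 ≤ Real.log (Real.exp 1 + y) := by
  rw [Real.le_log_iff_exp_le (by positivity)]
  linarith

/-- Subadditivity of `y ↦ y ^ s / log (e + y) ^ q`. -/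
theorem rpow_sum_div_log_le {ι : Type*} (t : Finset ι) {y : ι → ℝ} (hy : ∀ i, 0 < y i) {s q : ℝ}
    (hs : 0 < s) (hs1 : s ≤ 1) (hq : 0 ≤ q) :
    (∑ i ∈ t, y i) ^ s / Real.log (Real.exp 1 + ∑ i ∈ t, y i) ^ q ≤
      ∑ i ∈ t, y i ^ s / Real.log (Real.exp 1 + y i) ^ q := by
  set Y := ∑ i ∈ t, y i with hY
  have hY0 : 0 ≤ Y := Finset.sum_nonneg fun i _ => (hy i).le
  have hlog : ∀ z : ℝ, 0 ≤ z → 0 < Real.log (Real.exp 1 + z) := fun z hz =>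
    one_pos.trans_le (one_le_log_exp_one_add hz)
  rcases hY0.eq_or_lt with h0 | hpos
  · rw [← h0, Real.zero_rpow hs.ne', zero_div]
    exact Finset.sum_nonneg fun i _ =>
      div_nonneg (Real.rpow_nonneg (hy i).le _) (Real.rpow_nonneg (hlog _ (hy i).le).le _)
  -- Write `z^s = z · z^(s-1)`: since `z^(s-1) / log(e+z)^q` is decreasing, its value at the sum is
  -- at most its value at each `y i`.
  have hsplit : ∀ z : ℝ, 0 < z → z ^ s = z * z ^ (s - 1) := fun z hz => by
    rw [Real.rpow_sub_one hz.ne']; field_simp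
  rw [hsplit Y hpos, mul_div_assoc]
  nth_rw 1 [hY]
  rw [Finset.sum_mul]
  refine Finset.sum_le_sum fun i hi => ?_
  rw [hsplit _ (hy i), mul_div_assoc]
  have hle : y i ≤ Y := Finset.single_le_sum (fun j _ => (hy j).le) hi
  have h1 := hlog _ (hy i).le
  have h2 : Real.log (Real.exp 1 + y i) ≤ Real.log (Real.exp 1 + Y) :=
    Real.log_le_log (add_pos (Real.exp_pos 1) (hy i)) (by linarith)
  have h3 : Y ^ (s - 1) ≤ y i ^ (s - 1) :=
    Real.rpow_le_rpow_of_nonpos (hy i) hle (by linarith)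
  have h4 : Real.log (Real.exp 1 + y i) ^ q ≤ Real.log (Real.exp 1 + Y) ^ q :=
    Real.rpow_le_rpow h1.le h2 hq
  exact mul_le_mul_of_nonneg_left
    (div_le_div₀ (Real.rpow_nonneg (hy i).le _) h3 (Real.rpow_pos_of_pos h1 _) h4) (hy i).le

/-- Asymptotic inversion of `y ↦ y ^ (1 / κ) / log (e + y) ^ q`. -/
theorem exists_le_mul_rpow_mul_log {κ q K : ℝ} (hκ : 0 < κ) (hq : 0 ≤ q) (hK : 0 < K) :
    ∃ K' : ℝ, 0 < K' ∧ ∀ᶠ n : ℕ in atTop, ∀ Y : ℝ, 0 ≤ Y →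
      Y ^ κ⁻¹ ≤ K * n * Real.log (Real.exp 1 + Y) ^ q →
        Y ≤ K' * ((n : ℝ) ^ κ * Real.log n ^ (q * κ)) := by
  have hs : 0 < κ⁻¹ := inv_pos.2 hκ
  obtain ⟨Z₀, hZ₀⟩ := eventually_atTop.1
    ((isLittleO_log_rpow_rpow_atTop q (half_pos hs)).bound one_pos)
  set A : ℝ := (2 ^ κ⁻¹ * K) ^ (2 * κ) with hA
  refine ⟨(K * (2 * κ + 1) ^ q) ^ κ, by positivity, ?_⟩
  filter_upwards [tendsto_natCast_atTop_atTop.eventually_ge_atTop (max Z₀ (2 * Real.exp 1)),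
    tendsto_natCast_atTop_atTop.eventually_ge_atTop A, eventually_ge_atTop 1]
    with n hn1 hn2 hn3 Y hY hle
  have hn : (1 : ℝ) ≤ n := Nat.one_le_cast.2 hn3
  have hn0 : (0 : ℝ) < n := by linarith
  set Z := Real.exp 1 + Y with hZ
  have hZpos : 0 < Z := by positivity
  have hZlog : 1 ≤ Real.log Z := one_le_log_exp_one_add hY
  -- Bootstrap: absorbing `log^q` into `Z^(1/(2κ))` first gives the crude bound `Z ≤ A n^(2κ)`. It
  -- yields `log Z = O(log n)`, which is then fed back into the hypothesis.
  have hZn : Z ≤ (n : ℝ) ^ (2 * κ + 1) := by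
    have hnn : (n : ℝ) ≤ (n : ℝ) ^ (2 * κ + 1) := by
      nth_rw 1 [← Real.rpow_one (n : ℝ)]
      exact Real.rpow_le_rpow_of_exponent_le hn (by linarith)
    rcases le_total Z (max Z₀ (2 * Real.exp 1)) with h | h
    · exact (h.trans hn1).trans hnn
    · have h1 : Real.log Z ^ q ≤ Z ^ (κ⁻¹ / 2) := by
        have := hZ₀ Z ((le_max_left _ _).trans h)
        rwa [one_mul, Real.norm_of_nonneg (by positivity), Real.norm_of_nonneg (by positivity)]
          at this
      have h2 : Z ≤ 2 * Y := by
        have := (le_max_right _ _).trans h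
        linarith
      have h3 : Z ^ κ⁻¹ = Z ^ (κ⁻¹ / 2) * Z ^ (κ⁻¹ / 2) := by
        rw [← Real.rpow_add hZpos, add_halves]
      have h4 : Z ^ (κ⁻¹ / 2) * Z ^ (κ⁻¹ / 2) ≤ (2 ^ κ⁻¹ * K * n) * Z ^ (κ⁻¹ / 2) := by
        rw [← h3]
        calc Z ^ κ⁻¹ ≤ (2 * Y) ^ κ⁻¹ := Real.rpow_le_rpow hZpos.le h2 hs.le
          _ = 2 ^ κ⁻¹ * Y ^ κ⁻¹ := Real.mul_rpow (by norm_num) hY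
          _ ≤ 2 ^ κ⁻¹ * (K * n * Real.log Z ^ q) := by gcongr
          _ ≤ 2 ^ κ⁻¹ * (K * n * Z ^ (κ⁻¹ / 2)) := by gcongr
          _ = _ := by ring
      have h5 : Z ^ (κ⁻¹ / 2) ≤ 2 ^ κ⁻¹ * K * n :=
        le_of_mul_le_mul_right h4 (Real.rpow_pos_of_pos hZpos _)
      have h6 := Real.rpow_le_rpow (by positivity) h5 (show 0 ≤ 2 * κ by positivity)
      rw [← Real.rpow_mul hZpos.le, show κ⁻¹ / 2 * (2 * κ) = 1 by field_simp, Real.rpow_one,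
        Real.mul_rpow (by positivity) hn0.le, ← hA] at h6
      refine h6.trans ?_
      rw [Real.rpow_add hn0, Real.rpow_one, mul_comm]
      gcongr
  have hlogZ : Real.log Z ≤ (2 * κ + 1) * Real.log n := by
    rw [← Real.log_rpow hn0]
    exact Real.log_le_log hZpos hZn
  have hlogn : 0 ≤ Real.log n := Real.log_nonneg hn
  have h7 : Y ^ κ⁻¹ ≤ K * n * ((2 * κ + 1) * Real.log n) ^ q := by
    refine hle.trans ?_
    gcongr
  have h8 := Real.rpow_le_rpow (by positivity) h7 hκ.le
  rw [← Real.rpow_mul hY, inv_mul_cancel₀ hκ.ne', Real.rpow_one] at h8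
  refine h8.trans (le_of_eq ?_)
  rw [Real.mul_rpow (by positivity) hlogn, show K * n * ((2 * κ + 1) ^ q * Real.log n ^ q) =
    (K * (2 * κ + 1) ^ q) * (n * Real.log n ^ q) by ring,
    Real.mul_rpow (by positivity) (by positivity), Real.mul_rpow hn0.le (by positivity),
    ← Real.rpow_mul hlogn]

variable {X : Type*} [MetricSpace X] [MeasurableSpace X] {T : X → X}
  {μ : Measure X} [IsProbabilityMeasure μ] {p : X} {D : ℕ} {k c C : ℝ}

/-- Almost every orbit therefore avoids `p`, so the Birkhoff sums are finite. -/
theorem measure_singleton_eq_zero_of_ball_le (hD : 0 < D)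
    (hbd : ∀ r, 0 < r → r ≤ 1 →
      c * r ^ D ≤ μ.real (Metric.ball p r) ∧ μ.real (Metric.ball p r) ≤ C * r ^ D) :
    μ {p} = 0 := by
  have h1 : Tendsto (fun r : ℝ => C * r ^ D) (𝓝[>] 0) (𝓝 0) := by
    have : Tendsto (fun r : ℝ => C * r ^ D) (𝓝 0) (𝓝 (C * 0 ^ D)) :=
      ((continuous_pow D).const_mul C).tendsto 0
    rw [zero_pow hD.ne', mul_zero] at this
    exact this.mono_left nhdsWithin_le_nhds
  have h2 : μ.real {p} ≤ 0 := by
    refine ge_of_tendsto h1 ?_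
    filter_upwards [Ioc_mem_nhdsGT (zero_lt_one (α := ℝ))] with r hr
    refine le_trans (measureReal_mono ?_) (hbd r hr.1 hr.2).2
    exact singleton_subset_iff.2 (Metric.mem_ball_self hr.1)
  exact (measureReal_eq_zero_iff).1 (le_antisymm h2 measureReal_nonneg)

variable [BorelSpace X]

/-- Away from `p` this weight is `y^(D/k) / log(e+y)^q` at `y = φ(x)`. -/
theorem measurable_weight (p : X) (D : ℕ) (k q : ℝ) : Measurable fun x : X =>
    (dist x p ^ D)⁻¹ / Real.log (Real.exp 1 + dist x p ^ (-k)) ^ q := by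
  have hd : Measurable fun x : X => dist x p :=
    (continuous_id.dist continuous_const).measurable
  exact (hd.pow_const D).inv.div
    ((Real.measurable_log.comp ((hd.pow_const (-k)).const_add _)).pow_const q)

theorem exists_mul_le_log_exp_one_add_two_pow (hk : 0 < k) :
    ∃ θ : ℝ, 0 < θ ∧ ∀ i : ℕ,
      θ * ((i : ℝ) + 1) ≤ Real.log (Real.exp 1 + ((2 : ℝ) ^ i) ^ k) := by
  have hl2 : 0 < Real.log 2 := Real.log_pos (by norm_num)
  refine ⟨min (1 / 2) (k * Real.log 2 / 2), by positivity, fun i => ?_⟩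
  have h1 : 1 ≤ Real.log (Real.exp 1 + ((2 : ℝ) ^ i) ^ k) := one_le_log_exp_one_add (by positivity)
  have h2 : i * (k * Real.log 2) ≤ Real.log (Real.exp 1 + ((2 : ℝ) ^ i) ^ k) := by
    have : Real.log (((2 : ℝ) ^ i) ^ k) = i * (k * Real.log 2) := by
      rw [Real.log_rpow (by positivity), Real.log_pow]; ring
    rw [← this]
    exact Real.log_le_log (by positivity) (by linarith [Real.exp_pos 1])
  have h3 : min (1 / 2) (k * Real.log 2 / 2) ≤ 1 / 2 := min_le_left _ _
  have h4 : min (1 / 2) (k * Real.log 2 / 2) ≤ k * Real.log 2 / 2 := min_le_right _ _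
  have h5 := mul_le_mul_of_nonneg_right h4 (Nat.cast_nonneg (α := ℝ) i)
  linarith

/-- At distance about `2^(-i)` the weight is of order at most `2^(iD) (i+1)^(-q)`, while the ball
has measure at most `C 2^(-iD)`. The products are summable because `q > 1`. -/
theorem integrable_weight (hC : 0 < C)
    (hbd : ∀ r, 0 < r → r ≤ 1 →
      c * r ^ D ≤ μ.real (Metric.ball p r) ∧ μ.real (Metric.ball p r) ≤ C * r ^ D)
    (hk : 0 < k) {q : ℝ} (hq : 1 < q) : Integrable (fun x : X =>
      (dist x p ^ D)⁻¹ / Real.log (Real.exp 1 + dist x p ^ (-k)) ^ q) μ := by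
  set f : X → ℝ := fun x =>
    (dist x p ^ D)⁻¹ / Real.log (Real.exp 1 + dist x p ^ (-k)) ^ q with hf
  have hlog : ∀ z : ℝ, 0 ≤ z → 1 ≤ Real.log (Real.exp 1 + z) := fun z hz =>
    one_le_log_exp_one_add hz
  have hf0 : ∀ x, 0 ≤ f x := fun x => by
    have := hlog (dist x p ^ (-k)) (Real.rpow_nonneg dist_nonneg _)
    exact div_nonneg (by positivity) (Real.rpow_nonneg (by linarith) _)
  obtain ⟨θ, hθ, hθlog⟩ := exists_mul_le_log_exp_one_add_two_pow hk
  set b : ℕ → ℝ := fun i =>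
    ((2 : ℝ) ^ (i + 2)) ^ D / Real.log (Real.exp 1 + ((2 : ℝ) ^ i) ^ k) ^ q with hb
  have hb0 : ∀ i, 0 ≤ b i := fun i => by
    have := hlog (((2 : ℝ) ^ i) ^ k) (by positivity)
    positivity
  set B : ℕ → Set X := fun i => Metric.ball p ((1 / 2 : ℝ) ^ i) with hB
  have hpt : ∀ x, ENNReal.ofReal (f x) ≤
      ENNReal.ofReal (2 ^ D) + ∑' i, (B i).indicator (fun _ => ENNReal.ofReal (b i)) x := by
    intro x
    have hlogx := hlog (dist x p ^ (-k)) (Real.rpow_nonneg dist_nonneg _)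
    rcases le_or_gt (1 / 2) (dist x p) with h | h
    · refine le_trans (ENNReal.ofReal_le_ofReal ?_) le_self_add
      refine (div_le_self (by positivity) (Real.one_le_rpow hlogx (by linarith))).trans ?_
      rw [← inv_pow]
      gcongr
      exact inv_le_of_inv_le₀ two_pos (by rwa [← one_div])
    rcases (dist_nonneg (x := x) (y := p)).eq_or_lt with h0 | hpos
    · rw [hf]
      simp only [← h0]
      -- At `p` the convention `0⁻¹ = 0` makes the weight vanish when `D > 0`.
      rcases Nat.eq_zero_or_pos D with rfl | hD
      · refine le_trans (ENNReal.ofReal_le_ofReal ?_) le_self_add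
        rw [h0]
        simp only [pow_zero, inv_one]
        exact div_le_self zero_le_one (Real.one_le_rpow hlogx (by linarith))
      · simp [zero_pow hD.ne']
    -- Locating `2 * dist x p` rather than the distance puts `x` strictly inside the open ball of
    -- radius `2^(-i)`.
    obtain ⟨i, hi1, hi2⟩ := exists_nat_pow_near_of_lt_one (x := 2 * dist x p) (y := (1 / 2 : ℝ))
      (by positivity) (by linarith) (by norm_num) (by norm_num)
    have hxB : x ∈ B i := by
      rw [hB, Metric.mem_ball]; linarith
    refine le_trans ?_ le_add_self
    refine le_trans ?_ (ENNReal.le_tsum i)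
    rw [indicator_of_mem hxB]
    apply ENNReal.ofReal_le_ofReal
    have h1 : (dist x p)⁻¹ ≤ 2 ^ (i + 2) := by
      apply inv_le_of_inv_le₀ (by positivity)
      rw [← inv_pow, ← one_div, pow_succ]
      linarith
    have h2 : ((2 : ℝ) ^ i) ^ k ≤ dist x p ^ (-k) := by
      rw [Real.rpow_neg hpos.le, ← Real.inv_rpow hpos.le]
      apply Real.rpow_le_rpow (by positivity) _ hk.le
      apply le_inv_of_le_inv₀ hpos
      rw [← inv_pow, ← one_div]
      linarith
    have h3 := hlog (((2 : ℝ) ^ i) ^ k) (by positivity)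
    rw [hf, hb]
    simp only [← inv_pow]
    gcongr
  have hterm : ∀ i, ENNReal.ofReal (b i) * μ (B i) ≤
      ENNReal.ofReal (C * 4 ^ D * θ ^ (-q) * (1 / ((i + 1 : ℕ) : ℝ) ^ q)) := by
    intro i
    rw [← ofReal_measureReal (measure_ne_top _ _), ← ENNReal.ofReal_mul (hb0 i)]
    apply ENNReal.ofReal_le_ofReal
    have h1 := (hbd ((1 / 2 : ℝ) ^ i) (by positivity)
      (pow_le_one₀ (by norm_num) (by norm_num))).2
    have h2 : b i ≤ ((2 : ℝ) ^ (i + 2)) ^ D / (θ * ((i : ℝ) + 1)) ^ q := by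
      have := hθlog i
      simp only [hb]
      gcongr
    calc b i * μ.real (B i)
        ≤ ((2 : ℝ) ^ (i + 2)) ^ D / (θ * ((i : ℝ) + 1)) ^ q * (C * ((1 / 2 : ℝ) ^ i) ^ D) := by
          gcongr
      _ = _ := by
        rw [Real.mul_rpow hθ.le (by positivity), Real.rpow_neg hθ.le]
        have h3 : ((2 : ℝ) ^ (i + 2)) ^ D * ((1 / 2 : ℝ) ^ i) ^ D = 4 ^ D := by
          rw [← mul_pow, pow_add, mul_right_comm, ← mul_pow]
          norm_num
        rw [← h3]
        push_cast
        field_simp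
  refine ⟨(measurable_weight p D k q).aestronglyMeasurable, ?_⟩
  rw [hasFiniteIntegral_iff_ofReal (Eventually.of_forall hf0)]
  calc ∫⁻ x, ENNReal.ofReal (f x) ∂μ
      ≤ ∫⁻ x, (ENNReal.ofReal (2 ^ D) +
          ∑' i, (B i).indicator (fun _ => ENNReal.ofReal (b i)) x) ∂μ := lintegral_mono hpt
    _ = ENNReal.ofReal (2 ^ D) + ∑' i, ENNReal.ofReal (b i) * μ (B i) := by
      rw [lintegral_add_left measurable_const, lintegral_const, measure_univ, mul_one,
        lintegral_tsum fun i => (measurable_const.indicator Metric.isOpen_ball.measurableSet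
          ).aemeasurable]
      congr 1
      refine tsum_congr fun i => ?_
      rw [lintegral_indicator_const Metric.isOpen_ball.measurableSet]
    _ ≤ ENNReal.ofReal (2 ^ D) +
        ∑' i : ℕ, ENNReal.ofReal (C * 4 ^ D * θ ^ (-q) * (1 / ((i + 1 : ℕ) : ℝ) ^ q)) := by
      gcongr with i
      exact hterm i
    _ < ∞ := by
      refine ENNReal.add_lt_top.2 ⟨ENNReal.ofReal_lt_top, ?_⟩
      have hsum : Summable fun i : ℕ => C * 4 ^ D * θ ^ (-q) * (1 / ((i + 1 : ℕ) : ℝ) ^ q) :=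
        ((summable_nat_add_iff 1).2 (Real.summable_one_div_nat_rpow.2 hq)).mul_left _
      exact hsum.tsum_ofReal_lt_top

theorem limsup_S_div_eq_zero (hD : 0 < D) (hkD : (D : ℝ) ≤ k) (hC : 0 < C)
    (hbd : ∀ r, 0 < r → r ≤ 1 →
      c * r ^ D ≤ μ.real (Metric.ball p r) ∧ μ.real (Metric.ball p r) ≤ C * r ^ D)
    (hT : MeasurePreserving T μ μ) {ε : ℝ} (hε : 0 < ε) :
    ∀ᵐ x ∂μ, limsup (fun n : ℕ => S T p k n x /
      ENNReal.ofReal ((n : ℝ) ^ (k / D) * Real.log n ^ (k / D + ε))) atTop = 0 := by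
  have hD' : (0 : ℝ) < D := Nat.cast_pos.2 hD
  have hk : 0 < k := hD'.trans_le hkD
  set κ := k / D with hκdef
  have hκ : 0 < κ := by positivity
  have hκ1 : κ⁻¹ ≤ 1 := inv_le_one_of_one_le₀ ((one_le_div hD').2 hkD)
  -- Then `q > 1` and `q κ = κ + ε/2`; the other `ε/2` makes the quotient tend to zero.
  set q := 1 + ε / (2 * κ) with hqdef
  have hq : 1 < q := by rw [hqdef]; linarith [show 0 < ε / (2 * κ) by positivity]
  have hqκ : q * κ = κ + ε / 2 := by rw [hqdef]; field_simp
  have hlog : ∀ z : ℝ, 0 ≤ z → 1 ≤ Real.log (Real.exp 1 + z) := fun z hz =>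
    one_le_log_exp_one_add hz
  have hbirk := ae_exists_birkhoffSum_le hT (measurable_weight p D k q)
    (integrable_weight hC hbd hk hq) fun x => by
      have := hlog (dist x p ^ (-k)) (Real.rpow_nonneg dist_nonneg _)
      exact div_nonneg (by positivity) (Real.rpow_nonneg (by linarith) _)
  have hne : ∀ᵐ x ∂μ, ∀ j, T^[j] x ≠ p := by
    rw [ae_all_iff]
    intro j
    have h1 : ∀ᵐ x ∂μ, x ≠ p :=
      measure_eq_zero_iff_ae_notMem.1 (measure_singleton_eq_zero_of_ball_le hD hbd)
    exact (hT.iterate j).quasiMeasurePreserving.ae h1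
  filter_upwards [hbirk, hne] with x hx hxp
  obtain ⟨K, hK, hsum⟩ := hx
  set y : ℕ → ℝ := fun j => dist (T^[j] x) p ^ (-k) with hydef
  have hd : ∀ j, 0 < dist (T^[j] x) p := fun j => dist_pos.2 (hxp j)
  have hy : ∀ j, 0 < y j := fun j => Real.rpow_pos_of_pos (hd j) _
  have hS : ∀ n, S T p k n x = ENNReal.ofReal (∑ j ∈ Finset.range n, y j) := by
    intro n
    rw [ENNReal.ofReal_sum_of_nonneg fun j _ => (hy j).le]
    refine Finset.sum_congr rfl fun j _ => ?_
    rw [obs, edist_dist, ENNReal.ofReal_rpow_of_pos (hd j)]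
  obtain ⟨K', hK', hinv⟩ := exists_le_mul_rpow_mul_log hκ (q := q) (by linarith) hK
  have hbound : ∀ᶠ n : ℕ in atTop, ∑ j ∈ Finset.range n, y j ≤
      K' * ((n : ℝ) ^ κ * Real.log n ^ (κ + ε / 2)) := by
    filter_upwards [hinv] with n hn
    rw [← hqκ]
    have hY0 : 0 ≤ ∑ j ∈ Finset.range n, y j := Finset.sum_nonneg fun j _ => (hy j).le
    refine hn _ hY0 ?_
    have hL : 0 < Real.log (Real.exp 1 + ∑ j ∈ Finset.range n, y j) ^ q :=
      Real.rpow_pos_of_pos (one_pos.trans_le (hlog _ hY0)) _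
    rw [← div_le_iff₀ hL]
    refine (rpow_sum_div_log_le _ hy (inv_pos.2 hκ) hκ1 (by linarith)).trans ?_
    refine le_trans (le_of_eq (Finset.sum_congr rfl fun j _ => ?_)) (hsum n)
    have hpow : y j ^ κ⁻¹ = (dist (T^[j] x) p ^ D)⁻¹ := by
      rw [hydef]
      simp only
      rw [← Real.rpow_mul (hd j).le, hκdef, inv_div, neg_mul, mul_div_cancel₀ _ hk.ne',
        Real.rpow_neg (hd j).le, Real.rpow_natCast]
    rw [hpow]
  have hlogn : Tendsto (fun n : ℕ => Real.log n) atTop atTop :=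
    Real.tendsto_log_atTop.comp tendsto_natCast_atTop_atTop
  have hlim : Tendsto (fun n : ℕ => ENNReal.ofReal (K' * Real.log n ^ (-(ε / 2)))) atTop
      (𝓝 0) := by
    rw [← ENNReal.ofReal_zero]
    apply ENNReal.tendsto_ofReal
    have := ((tendsto_rpow_neg_atTop (half_pos hε)).comp hlogn).const_mul K'
    rwa [mul_zero] at this
  refine (tendsto_of_tendsto_of_tendsto_of_le_of_le' tendsto_const_nhds hlim
    (Eventually.of_forall fun _ => zero_le) ?_).limsup_eq
  filter_upwards [hbound, hlogn.eventually_gt_atTop 0, eventually_ge_atTop 1] with n h1 h2 hn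
  have hn0 : (0 : ℝ) < n := by exact_mod_cast hn
  have hpos : 0 < (n : ℝ) ^ κ * Real.log n ^ (κ + ε) := by positivity
  rw [hS, ← ENNReal.ofReal_div_of_pos hpos]
  apply ENNReal.ofReal_le_ofReal
  rw [div_le_iff₀ hpos]
  refine h1.trans (le_of_eq ?_)
  have : Real.log n ^ (κ + ε / 2) = Real.log n ^ (-(ε / 2)) * Real.log n ^ (κ + ε) := by
    rw [← Real.rpow_add h2]; congr 1; ring
  rw [this]
  ring

end UpperBound

end BirkhoffGrowth

/-! ### Assembly -/

theorem theorem1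
    {E : Type*} [NormedAddCommGroup E] [NormedSpace ℝ E]
    {H : Type*} [TopologicalSpace H] (I : ModelWithCorners ℝ E H)
    -- `X` is a Riemannian manifold of dimension `D`, with its Riemannian distance
    {X : Type*} [MetricSpace X] [ChartedSpace H X] [IsManifold I 1 X]
    [RiemannianBundle (fun x : X => TangentSpace I x)]
    [IsContinuousRiemannianBundle E (fun x : X => TangentSpace I x)]
    [IsRiemannianManifold I X]
    (D : ℕ) (hD : 0 < D) (hdim : Module.finrank ℝ E = D)
    -- the ergodic system `(T, X, μ)`
    [MeasurableSpace X] [BorelSpace X]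
    (T : X → X) (μ : Measure X) [IsProbabilityMeasure μ] (hT : Ergodic T μ)
    (p : X) (k : ℝ)
    -- the density at `p`, with respect to the `D`-dimensional Riemannian volume, lies in `(C₁, C₂)`
    (C₁ C₂ : ℝ) (hC₁ : 0 < C₁)
    (hlower : ENNReal.ofReal C₁ < BirkhoffGrowth.lowerDensity μ (μHE[D]) p)
    (hupper : BirkhoffGrowth.upperDensity μ (μHE[D]) p < ENNReal.ofReal C₂)
    (hSBC : BirkhoffGrowth.SBCAt T μ p) :
    ((D : ℝ) < k →
      (∀ ε : ℝ, 0 < ε → ∀ᵐ x ∂μ,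
        limsup (fun n : ℕ => BirkhoffGrowth.S T p k n x /
          ENNReal.ofReal ((n : ℝ) ^ (k / D) * Real.log n ^ (k / D + ε))) atTop = 0) ∧
      (∀ ε : ℝ, 0 < ε → ∀ᵐ x ∂μ,
        1 ≤ liminf (fun n : ℕ => BirkhoffGrowth.S T p k n x /
          ENNReal.ofReal ((n : ℝ) ^ (k / D - ε))) atTop) ∧
      (∀ᵐ x ∂μ, ∃ᶠ n : ℕ in atTop,
        ENNReal.ofReal ((n : ℝ) ^ (k / D) * Real.log n ^ (k / D)) ≤
          BirkhoffGrowth.S T p k n x) ∧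
      (BirkhoffGrowth.QSBCAt T μ p → ∀ ε : ℝ, 0 < ε → ∀ᵐ x ∂μ,
        1 < liminf (fun n : ℕ => BirkhoffGrowth.S T p k n x /
          ENNReal.ofReal ((n : ℝ) ^ (k / D) *
            Real.exp (-(Real.log n) ^ (1 / 2 + ε)) ^ (k / D))) atTop)) ∧
    (k = D →
      (∀ ε : ℝ, 0 < ε → ∀ᵐ x ∂μ,
        limsup (fun n : ℕ => BirkhoffGrowth.S T p k n x /
          ENNReal.ofReal ((n : ℝ) ^ (k / D) * Real.log n ^ (k / D + ε))) atTop = 0) ∧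
      (∀ᵐ x ∂μ, ∃ᶠ n : ℕ in atTop,
        ENNReal.ofReal ((n : ℝ) ^ (k / D) * Real.log n ^ (k / D)) ≤
          BirkhoffGrowth.S T p k n x) ∧
      (∃ δ : ℝ, 0 < δ ∧ ∀ᵐ x ∂μ,
        ENNReal.ofReal δ <
          liminf (fun n : ℕ => BirkhoffGrowth.S T p k n x / (n : ℝ≥0∞)) atTop)) := by
  -- `finrank` is `0` in infinite dimension, so a positive value forces finite dimension.
  have hfin : Module.Finite ℝ E := Module.finite_of_finrank_pos (hdim ▸ hD)
  obtain ⟨a, b, r₀, ha, hb, hr₀, hvol⟩ :=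
    BirkhoffGrowth.exists_bounds_euclideanHausdorffMeasure_ball I p
  rw [hdim] at hvol
  obtain ⟨c, C, hc, hC, hbd⟩ :=
    BirkhoffGrowth.exists_bounds_measure_ball ha hb hr₀ hvol hC₁ hlower hupper
  have hD' : (0 : ℝ) < D := Nat.cast_pos.2 hD
  refine ⟨fun hk => ⟨fun ε hε => ?_, fun ε hε => ?_, ?_, fun hQ ε hε => ?_⟩,
    fun hk => ⟨fun ε hε => ?_, ?_, ?_⟩⟩
  · exact BirkhoffGrowth.limsup_S_div_eq_zero hD hk.le hC hbd hT.toMeasurePreserving hε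
  · exact BirkhoffGrowth.one_le_liminf_S_div hD hk hc hC hbd hSBC hε
  · exact BirkhoffGrowth.frequently_le_S hD (hD'.trans hk).le hc hbd hSBC
  · exact BirkhoffGrowth.one_lt_liminf_S_div_of_QSBC hD (hD'.trans hk) hc hC hbd hQ hε
  · exact BirkhoffGrowth.limsup_S_div_eq_zero hD hk.ge hC hbd hT.toMeasurePreserving hε
  · exact BirkhoffGrowth.frequently_le_S hD (hk ▸ hD'.le) hc hbd hSBC
  · exact BirkhoffGrowth.exists_lt_liminf_S_div hD hk hc hC hbd hSBC
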